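/- Let $p$ be a prime and let $q$ be a power of $p$ of the form $q=2^ab-1$ with $a\ge 2$ and $b$ odd (so $p$ is odd). Let $r\ge 2$, $s\ge 0$ be integers and $n=2^rp^s$. Let $\beta$ be a primitive $2^r$-th root of unity in an extension field of $\mathbb F_q$, and for an integer $h$ let $m_h(x)$ be the minimal polynomial of $\beta^h$ over $\mathbb F_q$. For $3\le i\le r$ put $$O_i=\begin{cases}\{\pm1\}, & a=2,\\ \{1,3,3^2,\dots,3^{2^{i-2}-1}\}, & a\ge 3,\ i\le a,\\ \{\pm1,\pm3,\pm3^2,\dots,\pm3^{2^{a-2}-1}\}, & a\ge3,\ i\ge a+1,\end{cases}$$ and $T=\{0,2^{r-1},2^{r-2}\}\cup\bigcup_{i=3}^r 2^{r-i}O_i$. For integers $0\le j_h\le p^s$ $(h\in T)$ let $C\subseteq \mathbb F_q^n$ be the cyclic code given by the ideal of $\mathbb F_q[x]/(x^n-1)$ generated by $$m_0^{j_0}\,m_{2^{r-1}}^{j_{2^{r-1}}}\,m_{2^{r-2}}^{j_{2^{r-2}}}\prod_{i=3}^r\prod_{t\in O_i}m_{t2^{r-i}}^{j_{t2^{r-i}}}.$$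 Let $d_H(C)$ denote the minimum Hamming distance of $C$ and $C^\perp$ its Euclidean dual. If $C^\perp\subseteq C$, let $\mathrm{CSS}(C)\subseteq(\mathbb C^q)^{\otimes n}$ be the quantum code spanned by the states $\sum_{y\in C^\perp}|x+y\rangle$, $x\in C$. A quantum code is an $[[n,k,\delta]]_q$ code if it has dimension $q^k$ and minimum distance $\delta$, i.e. it detects all errors $\varsigma^i X_uZ_v$ of weight less than $\delta$, but not all those of weight $\delta$. (1) Let $a=2$. If $j_0,j_{2^{r-1}},j_{2^{r-2}}<p^s/2$ and $j_{t2^{r-i}}+j_{-t2^{r-i}}\le p^s$ for all $3\le i\le r$, $t\in O_i$, then $C^\perp\subseteq C$ and $\mathrm{CSS}(C)$ is an $[[n,k,\delta]]_q$ code with $$k=2^rp^s-2j_0-2j_{2^{r-1}}-4j_{2^{r-2}}-2\sum_{i=3}^r\sum_{t\in O_i}2^{i-a}j_{t2^{r-i}}$$ and $\delta\ge d_H(C)$, where $\delta=d_H(C)$ if and only if $C\setminus C^\perp$ contains a word of weight $d_H(C)$. The number of quantum codes $\mathrm{CSS}(C)$, where $C$ runs through all cyclic codes of length $n$ over $\mathbb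 F_q$ with $C^\perp\subseteq C$, equals $(p^s+2)^{r-2}\left(\frac{p^s+1}{2}\right)^{r+1}$. (2) Let $a\ge3$. If $j_0,j_{2^{r-1}},j_{2^{r-2}}<p^s/2$, $j_{t2^{r-i}}\le p^s/2$ for all $3\le i\le\min(a,r)$, $t\in O_i$, and $j_{t2^{r-i}}+j_{-t2^{r-i}}\le p^s$ for all $a+1\le i\le r$, $t\in O_i$, then $C^\perp\subseteq C$ and $\mathrm{CSS}(C)$ is an $[[n,k,\delta]]_q$ code with $$k=2^rp^s-2j_0-2j_{2^{r-1}}-4j_{2^{r-2}}-4\sum_{i=3}^{\min(a,r)}\sum_{t\in O_i}j_{t2^{r-i}}-2\sum_{i=a+1}^r\sum_{t\in O_i}2^{i-a}j_{t2^{r-i}}$$ and $\delta\ge d_H(C)$, where $\delta=d_H(C)$ if and only if $C\setminus C^\perp$ contains a word of weight $d_H(C)$. The number of quantum codes $\mathrm{CSS}(C)$, where $C$ runs through all cyclic codes of length $n$ over $\mathbb F_q$ with $C^\perp\subseteq C$, equals $(p^s+2)^{(r-a)2^{a-2}}\left(\frac{p^s+1}{2}\right)^{2^{a-1}+(r-a)2^{a-2}+1}$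 if $r\ge a$, and $\left(\frac{p^s+1}{2}\right)^{2^{r-1}+1}$ if $r<a$. -/

import Mathlib

open Polynomial

namespace QCode

section Classical

variable {F : Type*} [Field F] {n : ℕ}

/-- A linear code of length `n` is cyclic if it is closed under the cyclic shift
`(c₀, c₁, …, cₙ₋₁) ↦ (cₙ₋₁, c₀, …, cₙ₋₂)`. -/
def IsCyclicCode (C : Submodule F (Fin n → F)) : Prop :=
  ∀ c ∈ C, (fun i => c ((finRotate n).symm i)) ∈ C

/-- The Euclidean dual code. -/
def dualCode (C : Submodule F (Fin n → F)) : Submodule F (Fin n → F) where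
  carrier := {x | ∀ y ∈ C, x ⬝ᵥ y = 0}
  add_mem' := by
    intro x x' hx hx' y hy
    rw [add_dotProduct, hx y hy, hx' y hy, add_zero]
  zero_mem' := by
    intro y _
    exact zero_dotProduct y
  smul_mem' := by
    intro t x hx y hy
    rw [smul_dotProduct, hx y hy, smul_zero]

/-- The minimum Hamming distance of a code (a code with at least two words is meant). -/
noncomputable def minDist [DecidableEq F] (C : Submodule F (Fin n → F)) : ℕ :=
  sInf {d | ∃ x ∈ C, ∃ y ∈ C, x ≠ y ∧ hammingDist x y = d}

/-- The word `c` read as the polynomial `c₀ + c₁ X + ⋯ + cₙ₋₁ X ^ (n - 1)`. -/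
noncomputable def wordPoly (c : Fin n → F) : F[X] := ∑ i, C (c i) * X ^ (i : ℕ)

/-- The code of length `n` given by the ideal `⟨g⟩` of `F[X] / (X ^ n - 1)`. -/
noncomputable def generatedCode (n : ℕ) (g : F[X]) : Submodule F (Fin n → F) where
  carrier := {c | Ideal.Quotient.mk (Ideal.span {(X ^ n - 1 : F[X])}) (wordPoly c) ∈
    Ideal.span {Ideal.Quotient.mk (Ideal.span {(X ^ n - 1 : F[X])}) g}}
  add_mem' := by
    intro c c' hc hc'
    have h : wordPoly (c + c') = wordPoly c + wordPoly c' := by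
      simp [wordPoly, add_mul, Finset.sum_add_distrib]
    simp only [Set.mem_ofPred_eq] at hc hc' ⊢
    rw [h, map_add]
    exact Ideal.add_mem _ hc hc'
  zero_mem' := by
    have h : wordPoly (0 : Fin n → F) = 0 := by simp [wordPoly]
    simp only [Set.mem_ofPred_eq]
    rw [h, map_zero]
    exact Ideal.zero_mem _
  smul_mem' := by
    intro t c hc
    have h : wordPoly (t • c) = C t * wordPoly c := by
      simp [wordPoly, Finset.mul_sum, mul_assoc]
    simp only [Set.mem_ofPred_eq] at hc ⊢
    rw [h, map_mul]
    exact Ideal.mul_mem_left _ _ hc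

end Classical

section Cosets

/-- The sets `Oᵢ` (`3 ≤ i ≤ r`) of odd integers such that `0`, `2 ^ (r - 1)`, `2 ^ (r - 2)` and the
numbers `s * 2 ^ (r - i)` with `3 ≤ i ≤ r` and `s ∈ Oᵢ` represent the `q`-cyclotomic cosets modulo
`2 ^ r`, where `q = 2 ^ a * b - 1` with `b` odd. -/
def O (a i : ℕ) : Finset ℤ :=
  if a = 2 then {1, -1}
  else if i ≤ a then (Finset.range (2 ^ (i - 2))).image (fun k => (3 : ℤ) ^ k)
  else (Finset.range (2 ^ (a - 2))).image (fun k => (3 : ℤ) ^ k) ∪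
    (Finset.range (2 ^ (a - 2))).image (fun k => -(3 : ℤ) ^ k)

/-- The complete set of representatives of the `q`-cyclotomic cosets modulo `2 ^ r`. -/
def T (a r : ℕ) : Finset ℤ :=
  {0, 2 ^ (r - 1), 2 ^ (r - 2)} ∪
    (Finset.Icc 3 r).biUnion (fun i => (O a i).image (fun s => s * 2 ^ (r - i)))

/-- `m_h`, the minimal polynomial of `β ^ h` over `F`. -/
noncomputable def m (F : Type*) [Field F] {K : Type*} [Field K] [Algebra F K] (β : K) (h : ℤ) :
    F[X] := minpoly F (β ^ h)

/-- The generator polynomial with exponents `j_h`. -/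
noncomputable def genPoly (F : Type*) [Field F] {K : Type*} [Field K] [Algebra F K] (β : K)
    (a r : ℕ) (j : ℤ → ℕ) : F[X] :=
  m F β 0 ^ j 0 * m F β (2 ^ (r - 1)) ^ j (2 ^ (r - 1)) * m F β (2 ^ (r - 2)) ^ j (2 ^ (r - 2)) *
    ∏ i ∈ Finset.Icc 3 r, ∏ s ∈ O a i, m F β (s * 2 ^ (r - i)) ^ j (s * 2 ^ (r - i))

end Cosets

section Quantum

/-- The Hilbert space `(ℂ^q)^{⊗ n}`, through its orthonormal basis `|x⟩`, `x ∈ F ^ n`: a vector is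
given by its coordinates in this basis. -/
abbrev QSpace (F : Type*) (n : ℕ) : Type _ := EuclideanSpace ℂ (Fin n → F)

variable {F : Type*} [Field F] {n : ℕ}

/-- The unitary operator `X_a`, with `X_a |x⟩ = |x + a⟩`. -/
noncomputable def opX (a : Fin n → F) : QSpace F n →ₗ[ℂ] QSpace F n where
  toFun f := WithLp.toLp 2 (fun x => f (x - a))
  map_add' _ _ := rfl
  map_smul' _ _ := rfl

/-- The unitary operator `Z_b`, with `Z_b |x⟩ = ς ^ Tr(x · b) |x⟩`, where `ς = exp (2 π i / p)` and
`Tr` is the trace from `F` to its prime field. -/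
noncomputable def opZ (p : ℕ) [Fact p.Prime] [Algebra (ZMod p) F] (b : Fin n → F) :
    QSpace F n →ₗ[ℂ] QSpace F n where
  toFun f := WithLp.toLp 2
    (fun x => ZMod.stdAddChar (Algebra.trace (ZMod p) F (x ⬝ᵥ b)) * f x)
  map_add' f g := by
    ext x
    simp [mul_add]
  map_smul' t f := by
    ext x
    simp [mul_left_comm]

/-- The error operator `ς ^ i X_a Z_b`. -/
noncomputable def errorOp (p : ℕ) [Fact p.Prime] [Algebra (ZMod p) F] (i : ZMod p)
    (a b : Fin n → F) : QSpace F n →ₗ[ℂ] QSpace F n :=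
  (ZMod.stdAddChar i : ℂ) • (opX a ∘ₗ opZ p b)

/-- The weight of the error `ς ^ i X_a Z_b`: the number of tensor factors on which it is not a
scalar. -/
def errorWeight [DecidableEq F] (a b : Fin n → F) : ℕ :=
  (Finset.univ.filter (fun l => a l ≠ 0 ∨ b l ≠ 0)).card

/-- The code `Q`, with orthogonal projection `P`, detects the error `E`: `P E P` is a multiple
of `P`. -/
def Detects [Fintype F] (Q : Submodule ℂ (QSpace F n)) (E : QSpace F n →ₗ[ℂ] QSpace F n) : Prop :=
  ∃ t : ℂ, ∀ u ∈ Q, ∀ v ∈ Q, inner ℂ u (E v) = t * inner ℂ u v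

/-- `Q` is a quantum error-correcting code with parameters `[[n, k, d]]_q`, `q = |F|`: its dimension
is `q ^ k` and its minimum distance is exactly `d`, that is, `Q` detects every error of weight less
than `d` but not every error of weight `d`. -/
def IsQECCode (p : ℕ) [Fact p.Prime] [Algebra (ZMod p) F] [Fintype F] [DecidableEq F]
    (Q : Submodule ℂ (QSpace F n)) (k d : ℕ) : Prop :=
  Module.finrank ℂ Q = Fintype.card F ^ k ∧
  (∀ (i : ZMod p) (a b : Fin n → F), errorWeight a b < d → Detects Q (errorOp p i a b)) ∧
  ∃ (i : ZMod p) (a b : Fin n → F), errorWeight a b = d ∧ ¬ Detects Q (errorOp p i a b)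

/-- The (unnormalised) coset state `∑ y ∈ D, |x + y⟩`. -/
noncomputable def cosetState (D : Submodule F (Fin n → F)) (x : Fin n → F) : QSpace F n :=
  WithLp.toLp 2 (Set.indicator {y | y - x ∈ D} (fun _ => (1 : ℂ)))

/-- The quantum code that the CSS construction attaches to the linear codes `D ⊆ C`: the span of
the coset states `|x + D⟩` with `x ∈ C`. -/
noncomputable def css (C D : Submodule F (Fin n → F)) : Submodule ℂ (QSpace F n) :=
  Submodule.span ℂ (cosetState D '' C)

/-- The set of quantum codes obtained by the CSS construction from the dual-containing cyclic codes
of length `n` over `F`. -/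
def cyclicCSSCodes (F : Type*) [Field F] (n : ℕ) : Set (Submodule ℂ (QSpace F n)) :=
  {Q | ∃ C : Submodule F (Fin n → F), IsCyclicCode C ∧ dualCode C ≤ C ∧ Q = css C (dualCode C)}

/-- The CSS construction applies to the code `C` and yields a quantum code of length `n` and
dimension `q ^ k`; its minimum distance is at least that of `C`, and equal to it exactly when a
minimum weight word of `C` lies outside the dual code. -/
def CSSYields (p : ℕ) [Fact p.Prime] [Algebra (ZMod p) F] [Fintype F] [DecidableEq F]
    (C : Submodule F (Fin n → F)) (k : ℤ) : Prop :=
  dualCode C ≤ C ∧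
  ∃ k' d : ℕ, (k' : ℤ) = k ∧ IsQECCode p (css C (dualCode C)) k' d ∧ minDist C ≤ d ∧
    (d = minDist C ↔ ∃ c ∈ C, c ∉ dualCode C ∧ hammingNorm c = minDist C)

end Quantum

end QCode

namespace QCode

section DualCode

variable {F : Type*} [Field F] {n : ℕ}

theorem mem_dualCode {C : Submodule F (Fin n → F)} {x : Fin n → F} :
    x ∈ dualCode C ↔ ∀ y ∈ C, x ⬝ᵥ y = 0 := Iff.rfl

theorem dualCode_eq_orthogonal (C : Submodule F (Fin n → F)) :
    dualCode C = LinearMap.BilinForm.orthogonal (dotProductBilin F F) C := by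
  ext x
  simp only [mem_dualCode, LinearMap.BilinForm.mem_orthogonal_iff]
  exact forall₂_congr fun y _ => by rw [dotProduct_comm]; rfl

theorem dotProductBilin_isRefl :
    (dotProductBilin F F : LinearMap.BilinForm F (Fin n → F)).IsRefl := by
  intro x y h
  simp only [dotProductBilin_apply_apply] at h ⊢
  rw [dotProduct_comm, h]

theorem dotProductBilin_nondegenerate :
    (dotProductBilin F F : LinearMap.BilinForm F (Fin n → F)).Nondegenerate := by
  refine ⟨fun x h => ?_, fun x h => ?_⟩
  · exact dotProduct_eq_zero x fun y => h y
  · exact dotProduct_eq_zero x fun y => by rw [dotProduct_comm]; exact h y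

theorem finrank_dualCode (C : Submodule F (Fin n → F)) :
    Module.finrank F (dualCode C) = n - Module.finrank F C := by
  rw [dualCode_eq_orthogonal,
    LinearMap.BilinForm.finrank_orthogonal dotProductBilin_nondegenerate, Module.finrank_fin_fun]

theorem dualCode_dualCode (C : Submodule F (Fin n → F)) : dualCode (dualCode C) = C := by
  rw [dualCode_eq_orthogonal, dualCode_eq_orthogonal,
    LinearMap.BilinForm.orthogonal_orthogonal dotProductBilin_nondegenerate
      (dotProductBilin_isRefl (F := F) (n := n))]

end DualCode

section CSS

variable {F : Type*} [Field F] {n : ℕ}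

theorem cosetState_apply_of_mem {D : Submodule F (Fin n → F)} {x y : Fin n → F}
    (h : y - x ∈ D) : cosetState D x y = 1 :=
  Set.indicator_of_mem (s := {y | y - x ∈ D}) h (fun _ => (1 : ℂ))

theorem cosetState_apply_of_notMem {D : Submodule F (Fin n → F)} {x y : Fin n → F}
    (h : y - x ∉ D) : cosetState D x y = 0 :=
  Set.indicator_of_notMem (s := {y | y - x ∈ D}) h (fun _ => (1 : ℂ))

theorem cosetState_eq {D : Submodule F (Fin n → F)} {x y : Fin n → F} (h : x - y ∈ D) :
    cosetState D x = cosetState D y := by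
  ext z
  have : z - x ∈ D ↔ z - y ∈ D := by
    rw [← sub_add_sub_cancel z x y, D.add_mem_iff_left h]
  by_cases hz : z - x ∈ D
  · rw [cosetState_apply_of_mem hz, cosetState_apply_of_mem (this.1 hz)]
  · rw [cosetState_apply_of_notMem hz, cosetState_apply_of_notMem (mt this.2 hz)]

theorem cosetState_mem_css {C D : Submodule F (Fin n → F)} {x : Fin n → F} (hx : x ∈ C) :
    cosetState D x ∈ css C D :=
  Submodule.subset_span ⟨x, hx, rfl⟩

theorem apply_eq_zero_of_mem_css {C D : Submodule F (Fin n → F)} (hD : D ≤ C) {f : QSpace F n}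
    (hf : f ∈ css C D) {y : Fin n → F} (hy : y ∉ C) : f y = 0 := by
  induction hf using Submodule.span_induction with
  | mem f hf =>
    obtain ⟨x, hx, rfl⟩ := hf
    exact cosetState_apply_of_notMem fun h => hy (by simpa using C.add_mem (hD h) hx)
  | zero => rfl
  | add f g _ _ hf hg => rw [PiLp.add_apply, hf, hg, add_zero]
  | smul t f _ hf => rw [PiLp.smul_apply, hf, smul_zero]

theorem le_of_css_le {C C' D D' : Submodule F (Fin n → F)} (hD' : D' ≤ C')
    (h : css C D ≤ css C' D') : C ≤ C' := by
  intro x hx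
  by_contra hx'
  have h₁ := apply_eq_zero_of_mem_css hD' (h (cosetState_mem_css hx)) hx'
  rw [cosetState_apply_of_mem (by simp)] at h₁
  exact one_ne_zero h₁

theorem css_dualCode_inj {C C' : Submodule F (Fin n → F)} (hC : dualCode C ≤ C)
    (hC' : dualCode C' ≤ C') (h : css C (dualCode C) = css C' (dualCode C')) : C = C' :=
  le_antisymm (le_of_css_le hC' h.le) (le_of_css_le hC h.ge)

theorem cosetState_ne_zero (D : Submodule F (Fin n → F)) (x : Fin n → F) :
    cosetState D x ≠ 0 := by
  intro h
  have h₁ := congrArg (fun f : QSpace F n => f x) h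
  simp only [cosetState_apply_of_mem (show x - x ∈ D by simp)] at h₁
  exact one_ne_zero h₁

theorem errorOp_apply (p : ℕ) [Fact p.Prime] [Algebra (ZMod p) F] (i : ZMod p)
    (a b : Fin n → F) (f : QSpace F n) (x : Fin n → F) :
    errorOp p i a b f x = ZMod.stdAddChar i *
      (ZMod.stdAddChar (Algebra.trace (ZMod p) F ((x - a) ⬝ᵥ b)) * f (x - a)) := rfl

theorem hammingNorm_le_errorWeight_left [DecidableEq F] (a b : Fin n → F) :
    hammingNorm a ≤ errorWeight a b :=
  Finset.card_le_card fun _ h => by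
    simp only [Finset.mem_filter, Finset.mem_univ, true_and] at h ⊢
    exact Or.inl h

theorem hammingNorm_le_errorWeight_right [DecidableEq F] (a b : Fin n → F) :
    hammingNorm b ≤ errorWeight a b :=
  Finset.card_le_card fun _ h => by
    simp only [Finset.mem_filter, Finset.mem_univ, true_and] at h ⊢
    exact Or.inr h

theorem errorWeight_zero_right [DecidableEq F] (a : Fin n → F) :
    errorWeight a 0 = hammingNorm a := by
  simp [errorWeight, hammingNorm]

theorem minDist_le_hammingNorm [DecidableEq F] {C : Submodule F (Fin n → F)} {c : Fin n → F}
    (hc : c ∈ C) (h0 : c ≠ 0) : minDist C ≤ hammingNorm c :=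
  Nat.sInf_le ⟨c, hc, 0, C.zero_mem, h0, hammingDist_zero_right c⟩

variable [Fintype F]

theorem inner_cosetState_left (D : Submodule F (Fin n → F)) (x : Fin n → F) (f : QSpace F n) :
    inner ℂ (cosetState D x) f = ∑ z, cosetState D x z * f z := by
  rw [PiLp.inner_apply]
  refine Finset.sum_congr rfl fun z _ => ?_
  by_cases hz : z - x ∈ D
  · rw [cosetState_apply_of_mem hz]; simp
  · rw [cosetState_apply_of_notMem hz]; simp

theorem inner_cosetState_of_notMem {D : Submodule F (Fin n → F)} {x y : Fin n → F}
    (h : x - y ∉ D) : inner ℂ (cosetState D x) (cosetState D y) = 0 := by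
  rw [inner_cosetState_left]
  refine Finset.sum_eq_zero fun z _ => ?_
  by_cases hx : z - x ∈ D
  · have hy : z - y ∉ D := fun hy => h (by simpa using D.sub_mem hy hx)
    rw [cosetState_apply_of_notMem hy, mul_zero]
  · rw [cosetState_apply_of_notMem hx, zero_mul]

/-- The dimension of a CSS code is the index of the inner code in the outer one. -/
theorem finrank_css {C D : Submodule F (Fin n → F)} (hD : D ≤ C) :
    Module.finrank ℂ (css C D) =
      Fintype.card F ^ (Module.finrank F C - Module.finrank F D) := by
  classical
  let D' := D.submoduleOf C
  let v : C ⧸ D' → QSpace F n := fun c => cosetState D (c.out : C)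
  have hout (c : C) : ((Submodule.Quotient.mk c : C ⧸ D').out : Fin n → F) - c ∈ D := by
    have h := (Submodule.Quotient.eq D').1
      (Submodule.Quotient.mk_out (Submodule.Quotient.mk c : C ⧸ D'))
    exact h
  have hspan : css C D = Submodule.span ℂ (Set.range v) := by
    refine congrArg _ (Set.ext fun f => ⟨?_, ?_⟩)
    · rintro ⟨x, hx, rfl⟩
      exact ⟨Submodule.Quotient.mk ⟨x, hx⟩, cosetState_eq (hout ⟨x, hx⟩)⟩
    · rintro ⟨c, rfl⟩
      exact ⟨_, c.out.2, rfl⟩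
  have hli : LinearIndependent ℂ v := by
    refine linearIndependent_of_ne_zero_of_inner_eq_zero (fun c => cosetState_ne_zero _ _) ?_
    intro c c' hcc'
    refine inner_cosetState_of_notMem fun h => hcc' ?_
    have h₁ : (Submodule.Quotient.mk c.out : C ⧸ D') = Submodule.Quotient.mk c'.out :=
      (Submodule.Quotient.eq D').2 h
    simpa using h₁
  have : Fintype (C ⧸ D') := Fintype.ofFinite _
  rw [hspan, finrank_span_eq_card hli, Module.card_eq_pow_finrank (K := F) (V := C ⧸ D')]
  congr 1
  have h₁ := D'.finrank_quotient_add_finrank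
  have h₂ : Module.finrank F D' = Module.finrank F D :=
    (Submodule.submoduleOfEquivOfLe hD).finrank_eq
  omega

theorem detects_of_generators {C D : Submodule F (Fin n → F)}
    {E : QSpace F n →ₗ[ℂ] QSpace F n} (t : ℂ)
    (h : ∀ x ∈ C, ∀ y ∈ C, inner ℂ (cosetState D x) (E (cosetState D y)) =
      t * inner ℂ (cosetState D x) (cosetState D y)) : Detects (css C D) E := by
  refine ⟨t, fun u hu v hv => ?_⟩
  induction hu, hv using Submodule.span_induction₂ with
  | mem_mem u v hu hv =>
    obtain ⟨x, hx, rfl⟩ := hu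
    obtain ⟨y, hy, rfl⟩ := hv
    exact h x hx y hy
  | zero_left | zero_right => simp
  | add_left _ _ _ _ _ _ h₁ h₂ => rw [inner_add_left, inner_add_left, h₁, h₂, mul_add]
  | add_right _ _ _ _ _ _ h₁ h₂ =>
    rw [map_add, inner_add_right, inner_add_right, h₁, h₂, mul_add]
  | smul_left _ _ _ _ _ h₁ => rw [inner_smul_left, inner_smul_left, h₁]; ring
  | smul_right _ _ _ _ _ h₁ => rw [map_smul, inner_smul_right, inner_smul_right, h₁]; ring

variable {p : ℕ} [Fact p.Prime] [Algebra (ZMod p) F]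

theorem exists_stdAddChar_trace_ne_one {x : F} (hx : x ≠ 0) :
    ∃ t : F, (ZMod.stdAddChar (Algebra.trace (ZMod p) F (t * x)) : ℂ) ≠ 1 := by
  by_contra! h
  refine hx ((traceForm_nondegenerate (ZMod p) F).1 x fun t => ?_)
  have h₁ := h t
  rw [← AddChar.map_zero_eq_one (ZMod.stdAddChar (N := p))] at h₁
  rw [Algebra.traceForm_apply, mul_comm]
  exact ZMod.injective_stdAddChar h₁

/-- An error whose two parts lie in the dual code acts on the CSS code as a scalar. -/
theorem detects_of_mem_dualCode {C : Submodule F (Fin n → F)} (hC : dualCode C ≤ C)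
    (i : ZMod p) {a b : Fin n → F} (ha : a ∈ dualCode C) (hb : b ∈ dualCode C) :
    Detects (css C (dualCode C)) (errorOp p i a b) := by
  refine detects_of_generators (ZMod.stdAddChar i) fun x hx y hy => ?_
  rw [inner_cosetState_left, inner_cosetState_left, Finset.mul_sum]
  refine Finset.sum_congr rfl fun z _ => ?_
  rw [errorOp_apply]
  by_cases hz : z - y ∈ dualCode C
  · have hz' : z - a - y ∈ dualCode C := by
      rw [sub_right_comm]; exact (dualCode C).sub_mem hz ha
    have hzC : z - a ∈ C := by simpa using C.add_mem (hC hz') hy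
    have h0 : (z - a) ⬝ᵥ b = 0 := by rw [dotProduct_comm]; exact hb _ hzC
    rw [cosetState_apply_of_mem hz, cosetState_apply_of_mem hz', h0,
      map_zero (Algebra.trace (ZMod p) F), AddChar.map_zero_eq_one]
    ring
  · have hz' : z - a - y ∉ dualCode C := by
      intro h
      apply hz
      rw [sub_right_comm] at h
      simpa using (dualCode C).add_mem h ha
    rw [cosetState_apply_of_notMem hz, cosetState_apply_of_notMem hz']
    ring

theorem detects_of_shift_notMem {C D : Submodule F (Fin n → F)} (hD : D ≤ C)
    (i : ZMod p) {a : Fin n → F} (b : Fin n → F) (ha : a ∉ C) :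
    Detects (css C D) (errorOp p i a b) := by
  refine detects_of_generators 0 fun x hx y hy => ?_
  rw [zero_mul, inner_cosetState_left]
  refine Finset.sum_eq_zero fun z _ => ?_
  rw [errorOp_apply]
  by_cases hz : z - x ∈ D
  · have hz' : z - a - y ∉ D := by
      intro h
      apply ha
      have h₁ := C.sub_mem (C.add_mem (hD hz) hx) (C.add_mem (hD h) hy)
      simpa using h₁
    rw [cosetState_apply_of_notMem hz']
    ring
  · rw [cosetState_apply_of_notMem hz]
    ring

theorem detects_of_phase_notMem {C : Submodule F (Fin n → F)}
    (i : ZMod p) (a : Fin n → F) {b : Fin n → F} (hb : b ∉ C) :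
    Detects (css C (dualCode C)) (errorOp p i a b) := by
  refine detects_of_generators 0 fun x hx y hy => ?_
  rw [zero_mul, inner_cosetState_left]
  obtain ⟨z, hz, hzb⟩ : ∃ z ∈ dualCode C, b ⬝ᵥ z ≠ 0 := by
    rw [← dualCode_dualCode C, mem_dualCode] at hb
    push Not at hb
    exact hb
  obtain ⟨t, ht⟩ := exists_stdAddChar_trace_ne_one (p := p) hzb
  have htz : t • z ∈ dualCode C := (dualCode C).smul_mem t hz
  have hshift (x w : Fin n → F) :
      cosetState (dualCode C) x (w + t • z) = cosetState (dualCode C) x w := by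
    have : w + t • z - x ∈ dualCode C ↔ w - x ∈ dualCode C := by
      rw [add_sub_right_comm, (dualCode C).add_mem_iff_left htz]
    by_cases hw : w - x ∈ dualCode C
    · rw [cosetState_apply_of_mem hw, cosetState_apply_of_mem (this.2 hw)]
    · rw [cosetState_apply_of_notMem hw, cosetState_apply_of_notMem (mt this.1 hw)]
  set S : ℂ := ∑ w, cosetState (dualCode C) x w * errorOp p i a b (cosetState (dualCode C) y) w
    with hS
  have key : S = ZMod.stdAddChar (Algebra.trace (ZMod p) F (t * b ⬝ᵥ z)) * S := by
    conv_lhs => rw [hS, ← Equiv.sum_comp (Equiv.addRight (t • z))]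
    rw [hS, Finset.mul_sum]
    refine Finset.sum_congr rfl fun w _ => ?_
    rw [Equiv.coe_addRight, hshift, errorOp_apply, errorOp_apply, add_sub_right_comm, hshift,
      add_dotProduct, map_add, AddChar.map_add_eq_mul, smul_dotProduct, smul_eq_mul,
      dotProduct_comm z b]
    ring
  by_contra hS0
  exact ht (mul_right_cancel₀ hS0 (by rw [one_mul]; exact key.symm))

theorem not_detects_shift {C D : Submodule F (Fin n → F)} {c : Fin n → F}
    (hc : c ∈ C) (hcD : c ∉ D) : ¬ Detects (css C D) (errorOp p 0 c 0) := by
  rintro ⟨t, ht⟩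
  have hE (y : Fin n → F) : errorOp p 0 c 0 (cosetState D y) = cosetState D (y + c) := by
    ext z
    rw [errorOp_apply, dotProduct_zero, map_zero (Algebra.trace (ZMod p) F),
      AddChar.map_zero_eq_one, one_mul, one_mul]
    have : z - c - y ∈ D ↔ z - (y + c) ∈ D := by rw [sub_sub, add_comm]
    by_cases hz : z - c - y ∈ D
    · rw [cosetState_apply_of_mem hz, cosetState_apply_of_mem (this.1 hz)]
    · rw [cosetState_apply_of_notMem hz, cosetState_apply_of_notMem (mt this.2 hz)]
  have h₀ := cosetState_mem_css (D := D) C.zero_mem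
  have h₂ := ht _ (cosetState_mem_css hc) _ h₀
  rw [hE, zero_add, inner_cosetState_of_notMem (x := c) (y := 0) (by simpa using hcD),
    mul_zero] at h₂
  exact cosetState_ne_zero D c (inner_self_eq_zero.1 h₂)

variable [DecidableEq F]

/-- The CSS construction for a code that strictly contains its dual. -/
theorem cssYields_of_dualCode_lt {C : Submodule F (Fin n → F)} (hC : dualCode C < C) {k : ℤ}
    (hk : ((Module.finrank F C - Module.finrank F (dualCode C) : ℕ) : ℤ) = k) :
    CSSYields p C k := by
  classical
  obtain ⟨hle, c₀, hc₀, hc₀'⟩ := SetLike.lt_iff_le_and_exists.1 hC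
  have hex : ∃ d, ∃ c ∈ C, c ∉ dualCode C ∧ hammingNorm c = d := ⟨_, c₀, hc₀, hc₀', rfl⟩
  obtain ⟨c, hc, hc', hcd⟩ := Nat.find_spec hex
  have hmin {c : Fin n → F} (hc : c ∈ C) (hc' : c ∉ dualCode C) :
      Nat.find hex ≤ hammingNorm c := Nat.find_min' hex ⟨c, hc, hc', rfl⟩
  have hdist : minDist C ≤ Nat.find hex := by
    rw [← hcd]
    exact minDist_le_hammingNorm hc fun h => hc' (h ▸ (dualCode C).zero_mem)
  refine ⟨hle, _, Nat.find hex, hk, ⟨finrank_css hle, fun i a b hab => ?_, 0, c, 0, ?_,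
    not_detects_shift hc hc'⟩, hdist, fun h => ⟨c, hc, hc', hcd.trans h⟩, ?_⟩
  · by_cases ha : a ∈ C
    · by_cases hb : b ∈ C
      · refine detects_of_mem_dualCode hle i ?_ ?_
        · by_contra h
          exact ((hmin ha h).trans (hammingNorm_le_errorWeight_left a b)).not_gt hab
        · by_contra h
          exact ((hmin hb h).trans (hammingNorm_le_errorWeight_right a b)).not_gt hab
      · exact detects_of_phase_notMem i a hb
    · exact detects_of_shift_notMem hle i b ha
  · rw [errorWeight_zero_right, hcd]
  · rintro ⟨c₁, hc₁, hc₁', h⟩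
    exact le_antisymm (h ▸ hmin hc₁ hc₁') hdist

end CSS

section CyclicCode

variable {F : Type*} [Field F] {n : ℕ}

theorem wordPoly_add (c c' : Fin n → F) : wordPoly (c + c') = wordPoly c + wordPoly c' := by
  simp [wordPoly, add_mul, Finset.sum_add_distrib]

theorem wordPoly_smul (t : F) (c : Fin n → F) : wordPoly (t • c) = C t * wordPoly c := by
  simp [wordPoly, Finset.mul_sum, mul_assoc]

theorem wordPoly_sub (c c' : Fin n → F) : wordPoly (c - c') = wordPoly c - wordPoly c' := by
  simp [wordPoly, sub_mul, Finset.sum_sub_distrib]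

theorem degree_wordPoly_lt (c : Fin n → F) : (wordPoly c).degree < n :=
  (degree_sum_le _ _).trans_lt <| (Finset.sup_lt_iff (WithBot.bot_lt_coe n)).2 fun i _ =>
    (degree_C_mul_X_pow_le _ _).trans_lt (WithBot.coe_lt_coe.2 i.2)

theorem coeff_wordPoly (c : Fin n → F) (i : Fin n) : (wordPoly c).coeff i = c i := by
  simp [wordPoly, coeff_C_mul, coeff_X_pow, Fin.val_inj]

theorem wordPoly_coeff {f : F[X]} (hf : f.degree < n) :
    wordPoly (fun i : Fin n => f.coeff i) = f := by
  ext k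
  by_cases hk : k < n
  · exact coeff_wordPoly (fun i : Fin n => f.coeff i) ⟨k, hk⟩
  · have hk' : (n : WithBot ℕ) ≤ k := by exact_mod_cast not_lt.1 hk
    rw [coeff_eq_zero_of_degree_lt ((degree_wordPoly_lt _).trans_le hk'),
      coeff_eq_zero_of_degree_lt (hf.trans_le hk')]

theorem wordPoly_injective : Function.Injective (wordPoly : (Fin n → F) → F[X]) := by
  intro c c' h
  ext i
  rw [← coeff_wordPoly c, h, coeff_wordPoly]

theorem mem_generatedCode {g : F[X]} (hg : g ∣ X ^ n - 1) {c : Fin n → F} :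
    c ∈ generatedCode n g ↔ g ∣ wordPoly c := by
  change Ideal.Quotient.mk (Ideal.span {(X ^ n - 1 : F[X])}) (wordPoly c) ∈
    Ideal.span {Ideal.Quotient.mk (Ideal.span {(X ^ n - 1 : F[X])}) g} ↔ _
  rw [Ideal.mem_span_singleton]
  refine ⟨?_, fun h => map_dvd _ h⟩
  rintro ⟨u, hu⟩
  obtain ⟨u, rfl⟩ := Ideal.Quotient.mk_surjective u
  rw [← map_mul, Ideal.Quotient.mk_eq_mk_iff_sub_mem, Ideal.mem_span_singleton] at hu
  simpa using dvd_add (hg.trans hu) (dvd_mul_right g u)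

theorem X_pow_sub_one_ne_zero (hn : 0 < n) : (X ^ n - 1 : F[X]) ≠ 0 :=
  (monic_X_pow_sub_C (1 : F) hn.ne').ne_zero

theorem natDegree_X_pow_sub_one : (X ^ n - 1 : F[X]).natDegree = n :=
  natDegree_X_pow_sub_C (r := (1 : F))

theorem ne_zero_of_dvd_X_pow_sub_one (hn : 0 < n) {g : F[X]} (hg : g ∣ X ^ n - 1) : g ≠ 0 :=
  ne_zero_of_dvd_ne_zero (X_pow_sub_one_ne_zero hn) hg

theorem natDegree_le_of_dvd_X_pow_sub_one (hn : 0 < n) {g : F[X]} (hg : g ∣ X ^ n - 1) :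
    g.natDegree ≤ n := by
  have h := natDegree_le_of_dvd hg (X_pow_sub_one_ne_zero hn)
  rwa [natDegree_X_pow_sub_one] at h

theorem finrank_generatedCode (hn : 0 < n) {g : F[X]} (hg : g ∣ X ^ n - 1) :
    Module.finrank F (generatedCode n g) = n - g.natDegree := by
  have hg0 := ne_zero_of_dvd_X_pow_sub_one hn hg
  have hdn := natDegree_le_of_dvd_X_pow_sub_one hn hg
  set d := g.natDegree with hd
  have hdeg : g.degree = d := degree_eq_natDegree hg0
  let L : (Fin (n - d) → F) →ₗ[F] (Fin n → F) :=
    { toFun := fun u i => (g * wordPoly u).coeff i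
      map_add' := fun u v => by ext i; simp [wordPoly_add, mul_add]
      map_smul' := fun t u => by ext i; simp [wordPoly_smul, mul_left_comm g] }
  have hL (u) : wordPoly (L u) = g * wordPoly u := by
    have hlt : (g * wordPoly u).degree < n := by
      rw [degree_mul, hdeg]
      refine (WithBot.add_lt_add_left (by simp) (degree_wordPoly_lt u)).trans_le ?_
      exact_mod_cast (Nat.add_sub_cancel' hdn).le
    exact wordPoly_coeff hlt
  have hinj : Function.Injective L := by
    intro u v huv
    have h := congrArg wordPoly huv
    rw [hL, hL] at h
    exact wordPoly_injective (mul_left_cancel₀ hg0 h)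
  have hrange : LinearMap.range L = generatedCode n g := by
    ext c
    rw [mem_generatedCode hg, LinearMap.mem_range]
    constructor
    · rintro ⟨u, rfl⟩
      rw [hL]
      exact dvd_mul_right _ _
    · rintro ⟨w, hw⟩
      have hwdeg : w.degree < (n - d : ℕ) := by
        by_cases hw0 : w = 0
        · rw [hw0, degree_zero]; exact WithBot.bot_lt_coe _
        have h := degree_wordPoly_lt c
        rw [hw, degree_mul, hdeg, degree_eq_natDegree hw0] at h
        rw [degree_eq_natDegree hw0]
        norm_cast at h ⊢
        omega
      refine ⟨fun i => w.coeff i, wordPoly_injective ?_⟩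
      rw [hL, wordPoly_coeff hwdeg, hw]
  rw [← hrange, LinearMap.finrank_range_of_inj hinj, Module.finrank_fin_fun]

theorem dvd_of_generatedCode_le (hn : 0 < n) {g g' : F[X]} (hg : g ∣ X ^ n - 1)
    (hg' : g' ∣ X ^ n - 1) (hle : generatedCode n g ≤ generatedCode n g') : g' ∣ g := by
  by_cases hd : g.degree < n
  · have h : (fun i : Fin n => g.coeff i) ∈ generatedCode n g := by
      rw [mem_generatedCode hg, wordPoly_coeff hd]
    have h' := hle h
    rwa [mem_generatedCode hg', wordPoly_coeff hd] at h'
  · obtain ⟨u, hu⟩ := hg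
    have h0 := X_pow_sub_one_ne_zero (F := F) hn
    have hg0 : g ≠ 0 := fun h => h0 (by rw [hu, h, zero_mul])
    have hu0 : u ≠ 0 := fun h => h0 (by rw [hu, h, mul_zero])
    have h := congrArg natDegree hu
    rw [natDegree_X_pow_sub_one, natDegree_mul hg0 hu0] at h
    rw [degree_eq_natDegree hg0, not_lt] at hd
    have hd' : n ≤ g.natDegree := by exact_mod_cast hd
    have hun : IsUnit u := by
      rw [isUnit_iff_degree_eq_zero, degree_eq_natDegree hu0]
      exact_mod_cast (by omega : u.natDegree = 0)
    rw [hu] at hg'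
    exact (hun.dvd_mul_right).1 hg'

theorem X_mul_wordPoly (c : Fin n → F) :
    (X ^ n - 1 : F[X]) ∣ X * wordPoly c - wordPoly fun i => c ((finRotate n).symm i) := by
  rcases n with _ | n
  · simp [wordPoly]
  have h : wordPoly (fun i => c ((finRotate (n + 1)).symm i)) =
      ∑ i : Fin (n + 1), C (c i) * X ^ (finRotate (n + 1) i : ℕ) := by
    rw [wordPoly, ← Equiv.sum_comp (finRotate (n + 1))]
    simp
  rw [h, wordPoly, Finset.mul_sum, ← Finset.sum_sub_distrib]
  refine Finset.dvd_sum fun i _ => ?_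
  rcases Fin.eq_castSucc_or_eq_last i with ⟨i, rfl⟩ | rfl
  · have : (finRotate (n + 1) i.castSucc : ℕ) = i + 1 := by
      rw [coe_finRotate_of_ne_last (Fin.castSucc_lt_last i).ne]; simp
    rw [this, Fin.val_castSucc]
    exact ⟨0, by ring⟩
  · rw [finRotate_last]
    exact ⟨C (c (Fin.last n)), by simp; ring⟩

theorem isCyclicCode_generatedCode {g : F[X]} (hg : g ∣ X ^ n - 1) :
    IsCyclicCode (generatedCode n g) := by
  intro c hc
  rw [mem_generatedCode hg] at hc ⊢
  have h := dvd_sub (hc.mul_left X) (hg.trans (X_mul_wordPoly c))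
  simpa using h

/-- Every cyclic code is generated by a monic divisor of `X ^ n - 1`. -/
theorem IsCyclicCode.exists_generator (hn : 0 < n) {D : Submodule F (Fin n → F)}
    (hD : IsCyclicCode D) : ∃ g : F[X], g.Monic ∧ g ∣ X ^ n - 1 ∧ D = generatedCode n g := by
  classical
  have hadd {f f' : F[X]} (hf : ∃ c ∈ D, (X ^ n - 1 : F[X]) ∣ f - wordPoly c)
      (hf' : ∃ c ∈ D, (X ^ n - 1 : F[X]) ∣ f' - wordPoly c) :
      ∃ c ∈ D, (X ^ n - 1 : F[X]) ∣ (f + f') - wordPoly c := by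
    obtain ⟨c, hc, h⟩ := hf
    obtain ⟨c', hc', h'⟩ := hf'
    refine ⟨c + c', D.add_mem hc hc', ?_⟩
    rw [wordPoly_add, add_sub_add_comm]
    exact dvd_add h h'
  have hX {f : F[X]} (hf : ∃ c ∈ D, (X ^ n - 1 : F[X]) ∣ f - wordPoly c) :
      ∃ c ∈ D, (X ^ n - 1 : F[X]) ∣ X * f - wordPoly c := by
    obtain ⟨c, hc, h⟩ := hf
    refine ⟨_, hD c hc, ?_⟩
    have h₁ := dvd_add (h.mul_left X) (X_mul_wordPoly c)
    rwa [mul_sub, sub_add_sub_cancel] at h₁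
  have hC (t : F) {f : F[X]} (hf : ∃ c ∈ D, (X ^ n - 1 : F[X]) ∣ f - wordPoly c) :
      ∃ c ∈ D, (X ^ n - 1 : F[X]) ∣ C t * f - wordPoly c := by
    obtain ⟨c, hc, h⟩ := hf
    refine ⟨_, D.smul_mem t hc, ?_⟩
    rw [wordPoly_smul, ← mul_sub]
    exact h.mul_left _
  let I : Ideal F[X] :=
    { carrier := {f | ∃ c ∈ D, (X ^ n - 1 : F[X]) ∣ f - wordPoly c}
      add_mem' := hadd
      zero_mem' := ⟨0, D.zero_mem, by simp [wordPoly]⟩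
      smul_mem' := by
        intro u f hf
        induction u using Polynomial.induction_on' with
        | add u v hu hv => rw [smul_eq_mul, add_mul]; exact hadd hu hv
        | monomial k t =>
          rw [smul_eq_mul, ← C_mul_X_pow_eq_monomial, mul_assoc]
          refine hC t ?_
          induction k with
          | zero => simpa using hf
          | succ k ih => rw [pow_succ', mul_assoc]; exact hX ih }
  have hmemI {f : F[X]} : f ∈ I ↔ ∃ c ∈ D, (X ^ n - 1 : F[X]) ∣ f - wordPoly c := Iff.rfl
  have hI : (X ^ n - 1 : F[X]) ∈ I := ⟨0, D.zero_mem, by simp [wordPoly]⟩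
  obtain ⟨g, hg⟩ := (IsPrincipalIdealRing.principal I).principal
  have hmem {f : F[X]} : f ∈ I ↔ g ∣ f := by
    rw [hg]; exact Ideal.mem_span_singleton
  have hg0 : g ≠ 0 := ne_zero_of_dvd_X_pow_sub_one hn (hmem.1 hI)
  have hassoc : Associated (normalize g) g := normalize_associated g
  refine ⟨normalize g, monic_normalize hg0, hassoc.dvd_iff_dvd_left.2 (hmem.1 hI), ?_⟩
  ext c
  rw [mem_generatedCode (hassoc.dvd_iff_dvd_left.2 (hmem.1 hI)), hassoc.dvd_iff_dvd_left, ← hmem,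
    hmemI]
  refine ⟨fun hc => ⟨c, hc, by simp⟩, ?_⟩
  rintro ⟨c', hc', h⟩
  rw [← wordPoly_sub] at h
  have h0 := eq_zero_of_dvd_of_degree_lt h (by
    refine (degree_wordPoly_lt _).trans_eq ?_
    exact (degree_X_pow_sub_C hn (1 : F)).symm)
  rw [wordPoly_sub, sub_eq_zero] at h0
  rwa [wordPoly_injective h0]

theorem dotProduct_eq_coeff_mul_reflect (x y : Fin n → F) :
    x ⬝ᵥ y = (wordPoly x * reflect (n - 1) (wordPoly y)).coeff (n - 1) := by
  rcases n with _ | n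
  · simp [wordPoly]
  rw [Nat.add_sub_cancel, coeff_mul, Finset.Nat.sum_antidiagonal_eq_sum_range_succ
    (fun i j => (wordPoly x).coeff i * (reflect n (wordPoly y)).coeff j), dotProduct,
    ← Fin.sum_univ_eq_sum_range (fun k => (wordPoly x).coeff k *
      (reflect n (wordPoly y)).coeff (n - k)) (n + 1)]
  refine Finset.sum_congr rfl fun i _ => ?_
  rw [coeff_reflect, revAt_le (Nat.sub_le _ _), Nat.sub_sub_self (by omega), coeff_wordPoly,
    coeff_wordPoly]

theorem reverse_X_pow_sub_one : (X ^ n - 1 : F[X]).reverse = -(X ^ n - 1) := by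
  rw [reverse, natDegree_X_pow_sub_one, reflect_sub, ← C_1, reflect_C, reflect_monomial]
  simp [revAt_le]

theorem generatedCode_reverse_le_dualCode (hn : 0 < n) {g h : F[X]} (hgh : g * h = X ^ n - 1) :
    generatedCode n h.reverse ≤ dualCode (generatedCode n g) := by
  intro x hx y hy
  have hrev : g.reverse * h.reverse = -(X ^ n - 1) := by
    rw [← reverse_mul_of_domain, hgh, reverse_X_pow_sub_one]
  have hg : g ∣ X ^ n - 1 := ⟨h, hgh.symm⟩
  have hh : h.reverse ∣ X ^ n - 1 := by
    rw [← dvd_neg, ← hrev]; exact dvd_mul_left _ _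
  rw [mem_generatedCode hh] at hx
  rw [mem_generatedCode hg] at hy
  obtain ⟨v, hv⟩ := hx
  obtain ⟨u, hu⟩ := hy
  rw [dotProduct_eq_coeff_mul_reflect]
  by_cases hx0 : wordPoly x = 0
  · simp [hx0]
  by_cases hy0 : wordPoly y = 0
  · simp [hy0]
  have hh0 : h.reverse ≠ 0 := fun h0 => hx0 (by rw [hv, h0, zero_mul])
  have hh1 : h ≠ 0 := fun h0 => hh0 (by rw [h0, reverse_zero])
  have hv0 : v ≠ 0 := fun h0 => hx0 (by rw [hv, h0, mul_zero])
  have hg0 : g ≠ 0 := fun h0 => hy0 (by rw [hu, h0, zero_mul])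
  have hu0 : u ≠ 0 := fun h0 => hy0 (by rw [hu, h0, mul_zero])
  have hnd := congrArg natDegree hgh
  rw [natDegree_X_pow_sub_one, natDegree_mul hg0 hh1] at hnd
  have hhdeg : h.reverse.natDegree = h.natDegree := by
    rw [reverse_natDegree, natTrailingDegree_eq_zero_of_constantCoeff_ne_zero, Nat.sub_zero]
    intro h0
    have h1 := congrArg (eval 0) hgh
    rw [eval_mul, ← coeff_zero_eq_eval_zero h] at h1
    rw [constantCoeff_apply] at h0
    rw [h0, mul_zero] at h1
    simp [hn.ne'] at h1
  have hxd := degree_wordPoly_lt x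
  rw [hv, degree_mul, degree_eq_natDegree hh0, degree_eq_natDegree hv0, hhdeg] at hxd
  have hyd := degree_wordPoly_lt y
  rw [hu, degree_mul, degree_eq_natDegree hg0, degree_eq_natDegree hu0] at hyd
  norm_cast at hxd hyd
  have hsplit : n - 1 = g.natDegree + (n - 1 - g.natDegree) := by omega
  have hrefl : reflect (n - 1) (wordPoly y) = g.reverse * reflect (n - 1 - g.natDegree) u := by
    conv_lhs => rw [hu, hsplit]
    exact reflect_mul g u le_rfl (by omega)
  have hw : wordPoly x * reflect (n - 1) (wordPoly y) =
      v * reflect (n - 1 - g.natDegree) u - X ^ n * (v * reflect (n - 1 - g.natDegree) u) := by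
    rw [hv, hrefl]
    linear_combination (v * reflect (n - 1 - g.natDegree) u) * hrev
  have hr : (reflect (n - 1 - g.natDegree) u).natDegree ≤ n - 1 - g.natDegree := by
    refine (natDegree_le_iff_coeff_eq_zero).2 fun k hk => ?_
    rw [coeff_reflect, revAt_eq_self_of_lt hk]
    exact coeff_eq_zero_of_natDegree_lt (by omega)
  rw [hw, coeff_sub, coeff_X_pow_mul', if_neg (by omega), sub_zero]
  refine coeff_eq_zero_of_natDegree_lt ((natDegree_mul_le).trans_lt ?_)
  omega

theorem dualCode_generatedCode (hn : 0 < n) {g h : F[X]} (hgh : g * h = X ^ n - 1) :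
    dualCode (generatedCode n g) = generatedCode n h.reverse := by
  have hrev : g.reverse * h.reverse = -(X ^ n - 1) := by
    rw [← reverse_mul_of_domain, hgh, reverse_X_pow_sub_one]
  have hg : g ∣ X ^ n - 1 := ⟨h, hgh.symm⟩
  have hh : h.reverse ∣ X ^ n - 1 := by
    rw [← dvd_neg, ← hrev]; exact dvd_mul_left _ _
  refine (Submodule.eq_of_le_of_finrank_le (generatedCode_reverse_le_dualCode hn hgh) ?_).symm
  rw [finrank_dualCode, finrank_generatedCode hn hg, finrank_generatedCode hn hh]
  have hle : h.reverse.natDegree ≤ h.natDegree := by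
    rw [reverse_natDegree]; exact Nat.sub_le _ _
  have hg0 := ne_zero_of_dvd_X_pow_sub_one hn hg
  have hh0 : h ≠ 0 := ne_zero_of_dvd_X_pow_sub_one hn ⟨g, by rw [mul_comm, hgh]⟩
  have hnd := congrArg natDegree hgh
  rw [natDegree_X_pow_sub_one, natDegree_mul hg0 hh0] at hnd
  omega

/-- A cyclic code contains its dual if and only if its generator times the reciprocal of its
generator divides `X ^ n - 1`. -/
theorem dualCode_generatedCode_le_iff (hn : 0 < n) {g : F[X]} (hg : g ∣ X ^ n - 1) :
    dualCode (generatedCode n g) ≤ generatedCode n g ↔ g * g.reverse ∣ X ^ n - 1 := by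
  obtain ⟨h, hgh⟩ := hg
  have hrev : g.reverse * h.reverse = -(X ^ n - 1) := by
    rw [← reverse_mul_of_domain, ← hgh, reverse_X_pow_sub_one]
  have hh : h.reverse ∣ X ^ n - 1 := by
    rw [← dvd_neg, ← hrev]; exact dvd_mul_left _ _
  have hg0 : g.reverse ≠ 0 := by
    rw [Ne, reverse_eq_zero]; exact ne_zero_of_dvd_X_pow_sub_one hn ⟨h, hgh⟩
  have key : g * g.reverse ∣ X ^ n - 1 ↔ g ∣ h.reverse := by
    rw [← dvd_neg, ← hrev, mul_comm g, mul_dvd_mul_iff_left hg0]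
  rw [key, dualCode_generatedCode hn hgh.symm]
  refine ⟨dvd_of_generatedCode_le hn hh ⟨h, hgh⟩, fun hd c hc => ?_⟩
  rw [mem_generatedCode hh] at hc
  rw [mem_generatedCode ⟨h, hgh⟩]
  exact hd.trans hc

end CyclicCode

section RootMult

variable {F K : Type*} [Field F] [Field K] [Algebra F K]

/-- The multiplicity of an element of an extension field as a root of a polynomial. -/
noncomputable def rootMult (g : F[X]) (x : K) : ℕ :=
  rootMultiplicity x (g.map (algebraMap F K))

theorem rootMult_mul {f g : F[X]} (hf : f ≠ 0) (hg : g ≠ 0) (x : K) :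
    rootMult (f * g) x = rootMult f x + rootMult g x := by
  rw [rootMult, Polynomial.map_mul, rootMultiplicity_mul]
  · rfl
  · rw [← Polynomial.map_mul, Polynomial.map_ne_zero_iff (algebraMap F K).injective]
    exact mul_ne_zero hf hg

theorem rootMult_one (x : K) : rootMult (1 : F[X]) x = 0 := by
  rw [rootMult, Polynomial.map_one, ← C_1, rootMultiplicity_C]

theorem rootMult_pow {f : F[X]} (hf : f ≠ 0) (k : ℕ) (x : K) :
    rootMult (f ^ k) x = k * rootMult f x := by
  induction k with
  | zero => rw [pow_zero, rootMult_one, zero_mul]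
  | succ k ih => rw [pow_succ, rootMult_mul (pow_ne_zero k hf) hf, ih, add_one_mul]

theorem rootMult_prod {ι : Type*} (s : Finset ι) (f : ι → F[X]) (hf : ∀ i ∈ s, f i ≠ 0) (x : K) :
    rootMult (∏ i ∈ s, f i) x = ∑ i ∈ s, rootMult (f i) x := by
  classical
  induction s using Finset.induction_on with
  | empty => rw [Finset.prod_empty, Finset.sum_empty, rootMult_one]
  | insert i s hi ih =>
    have hs : ∀ j ∈ s, f j ≠ 0 := fun j hj => hf j (Finset.mem_insert_of_mem hj)
    rw [Finset.prod_insert hi, Finset.sum_insert hi,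
      rootMult_mul (hf i (Finset.mem_insert_self i s)) (Finset.prod_ne_zero_iff.2 hs), ih hs]

theorem rootMultiplicity_reverse {p : K[X]} {x : K} (hx : x ≠ 0) :
    rootMultiplicity x p.reverse = rootMultiplicity x⁻¹ p := by
  by_cases hp : p = 0
  · simp [hp]
  obtain ⟨h, hh, hdvd⟩ := exists_eq_pow_rootMultiplicity_mul_and_not_dvd p hp x⁻¹
  have hrev : (X - C x⁻¹ : K[X]).reverse = C (-x⁻¹) * (X - C x) := by
    have h₁ : (X - C x⁻¹ : K[X]).reverse = 1 - C x⁻¹ * X := by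
      rw [reverse, natDegree_X_sub_C, reflect_sub, reflect_C]
      congr 1
      · simp
      · simp
    rw [h₁, mul_sub, ← C_mul]
    simp [hx]
    ring
  have hpow (k : ℕ) : ((X - C x⁻¹ : K[X]) ^ k).reverse = C (-x⁻¹) ^ k * (X - C x) ^ k := by
    induction k with
    | zero => simp only [pow_zero, mul_one]; rw [← C_1, reverse_C]
    | succ k ih => rw [pow_succ, reverse_mul_of_domain, ih, hrev]; ring
  have hroot : ¬ IsRoot h.reverse x := by
    intro h0
    apply hdvd
    rw [dvd_iff_isRoot]
    have h₁ := eval₂_reverse_eq_zero_iff (RingHom.id K) (Units.mk0 x hx)⁻¹.1 h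
    simp only [invOf_units, inv_inv, Units.val_mk0, Units.val_inv_eq_inv_val] at h₁
    simpa [IsRoot, eval₂_id] using h₁.1 (by simpa [IsRoot, eval₂_id] using h0)
  have hh0 : h.reverse ≠ 0 := fun h0 => hroot (by rw [h0]; simp)
  conv_lhs => rw [hh, reverse_mul_of_domain, hpow, ← C_pow]
  have hc : C ((-x⁻¹) ^ rootMultiplicity x⁻¹ p) ≠ 0 := by simp [hx]
  have hX := pow_ne_zero (rootMultiplicity x⁻¹ p) (X_sub_C_ne_zero x)
  rw [rootMultiplicity_mul (mul_ne_zero (mul_ne_zero hc hX) hh0),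
    rootMultiplicity_mul (mul_ne_zero hc hX), rootMultiplicity_C, rootMultiplicity_X_sub_C_pow,
    rootMultiplicity_eq_zero hroot]
  ring

theorem rootMult_reverse (g : F[X]) {x : K} (hx : x ≠ 0) :
    rootMult g.reverse x = rootMult g x⁻¹ := by
  rw [rootMult, rootMult, ← rootMultiplicity_reverse hx, reverse, reverse, ← reflect_map,
    natDegree_map]

theorem rootMult_le_of_dvd {f g : F[X]} (hg : g ≠ 0) (h : f ∣ g) (x : K) :
    rootMult f x ≤ rootMult g x :=
  rootMultiplicity_le_rootMultiplicity_of_dvd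
    ((Polynomial.map_ne_zero_iff (algebraMap F K).injective).2 hg)
    (Polynomial.map_dvd (algebraMap F K) h) x

theorem dvd_of_rootMult_le {f g : F[X]} (hf : (f.map (algebraMap F K)).Splits) (hf0 : f ≠ 0)
    (h : ∀ x : K, rootMult f x ≤ rootMult g x) : f ∣ g := by
  classical
  rw [← map_dvd_map' (algebraMap F K)]
  refine hf.dvd_of_roots_le_roots
    ((Polynomial.map_ne_zero_iff (algebraMap F K).injective).2 hf0) ?_
  rw [Multiset.le_iff_count]
  intro x
  rw [count_roots, count_roots]
  exact h x

section PrimitiveRoot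

theorem map_X_pow_sub_one (n : ℕ) :
    (X ^ n - 1 : F[X]).map (algebraMap F K) = X ^ n - 1 := by
  simp

variable {N : ℕ} {β : K}

variable (p : ℕ) [Fact p.Prime] [CharP F p] {s : ℕ}

theorem X_pow_mul_char_pow_sub_one :
    (X ^ (N * p ^ s) - 1 : F[X]) = (X ^ N - 1) ^ p ^ s := by
  rw [sub_pow_char_pow (p := p), one_pow, pow_mul]

theorem splits_of_dvd_X_pow_sub_one (hN : 0 < N) (hβ : IsPrimitiveRoot β N) {g : F[X]}
    (hg : g ∣ X ^ (N * p ^ s) - 1) : (g.map (algebraMap F K)).Splits := by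
  have h : (X ^ (N * p ^ s) - 1 : F[X]).map (algebraMap F K) = (X ^ N - 1) ^ p ^ s := by
    rw [X_pow_mul_char_pow_sub_one p, Polynomial.map_pow, map_X_pow_sub_one]
  refine Splits.of_dvd (g := (X ^ N - 1 : K[X]) ^ p ^ s) ((X_pow_sub_one_splits hβ).pow _) ?_ ?_
  · exact pow_ne_zero _ (X_pow_sub_one_ne_zero (F := K) hN)
  · rw [← h]
    exact Polynomial.map_dvd (algebraMap F K) hg

theorem rootMult_X_pow_sub_one [DecidableEq K] (hN : 0 < N) (hβ : IsPrimitiveRoot β N) (x : K) :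
    rootMult (X ^ (N * p ^ s) - 1 : F[X]) x = if x ^ N = 1 then p ^ s else 0 := by
  have hroot : rootMult (X ^ N - 1 : F[X]) x = if x ^ N = 1 then 1 else 0 := by
    have hnd := hβ.nthRoots_one_nodup
    rw [rootMult, map_X_pow_sub_one, ← count_roots, ← C_1]
    change Multiset.count x (nthRoots N 1) = _
    rw [Multiset.count_eq_of_nodup hnd]
    exact if_congr (mem_nthRoots hN) rfl rfl
  rw [X_pow_mul_char_pow_sub_one p, rootMult_pow (X_pow_sub_one_ne_zero hN), hroot]
  split_ifs <;> simp

theorem rootMult_le_of_dvd_X_pow_sub_one [DecidableEq K] (hN : 0 < N)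
    (hβ : IsPrimitiveRoot β N) {g : F[X]}
    (hg : g ∣ X ^ (N * p ^ s) - 1) (x : K) :
    rootMult g x ≤ if x ^ N = 1 then p ^ s else 0 := by
  rw [← rootMult_X_pow_sub_one (F := F) p hN hβ]
  have : 0 < p ^ s := pow_pos (Fact.out : p.Prime).pos s
  exact rootMult_le_of_dvd (X_pow_sub_one_ne_zero (by positivity)) hg x

theorem dvd_X_pow_sub_one_of_rootMult_le [DecidableEq K] (hN : 0 < N)
    (hβ : IsPrimitiveRoot β N) {g : F[X]}
    (hg0 : g ≠ 0) (hsplits : (g.map (algebraMap F K)).Splits)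
    (h : ∀ x : K, rootMult g x ≤ if x ^ N = 1 then p ^ s else 0) :
    g ∣ X ^ (N * p ^ s) - 1 :=
  dvd_of_rootMult_le hsplits hg0 fun x =>
    (h x).trans_eq (rootMult_X_pow_sub_one (F := F) p hN hβ x).symm

theorem eq_of_rootMult_eq (hN : 0 < N) (hβ : IsPrimitiveRoot β N) {f g : F[X]} (hf : f.Monic)
    (hg : g.Monic) (hfd : f ∣ X ^ (N * p ^ s) - 1) (hgd : g ∣ X ^ (N * p ^ s) - 1)
    (h : ∀ x : K, x ^ N = 1 → rootMult f x = rootMult g x) : f = g := by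
  have h' (x : K) : rootMult f x = rootMult g x := by
    classical
    by_cases hx : x ^ N = 1
    · exact h x hx
    · have h₁ := rootMult_le_of_dvd_X_pow_sub_one p hN hβ hfd x
      have h₂ := rootMult_le_of_dvd_X_pow_sub_one p hN hβ hgd x
      rw [if_neg hx] at h₁ h₂
      omega
  refine eq_of_monic_of_associated hf hg (associated_of_dvd_dvd ?_ ?_)
  · exact dvd_of_rootMult_le (splits_of_dvd_X_pow_sub_one p hN hβ hfd) hf.ne_zero
      fun x => (h' x).le
  · exact dvd_of_rootMult_le (splits_of_dvd_X_pow_sub_one p hN hβ hgd) hg.ne_zero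
      fun x => (h' x).ge

theorem natDegree_eq_sum_rootMult (hN : 0 < N) (hβ : IsPrimitiveRoot β N) {g : F[X]}
    (hg : g ∣ X ^ (N * p ^ s) - 1) :
    g.natDegree = ∑ x ∈ nthRootsFinset N (1 : K), rootMult g x := by
  classical
  rw [← natDegree_map (algebraMap F K),
    (splits_of_dvd_X_pow_sub_one p hN hβ hg).natDegree_eq_card_roots,
    ← Multiset.sum_count_eq_card (s := nthRootsFinset N (1 : K))]
  · exact Finset.sum_congr rfl fun x _ => count_roots _
  · intro x hx
    rw [mem_nthRootsFinset hN]
    by_contra h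
    have h₁ := rootMult_le_of_dvd_X_pow_sub_one p hN hβ hg x
    rw [if_neg h, Nat.le_zero, rootMult, ← count_roots, Multiset.count_eq_zero] at h₁
    exact h₁ hx

/-- Dual-containing cyclic codes, in terms of the multiplicities of the roots of the generator. -/
theorem dualCode_le_iff_rootMult (hN : 0 < N) (hβ : IsPrimitiveRoot β N) {g : F[X]}
    (hg : g ∣ X ^ (N * p ^ s) - 1) :
    dualCode (generatedCode (N * p ^ s) g) ≤ generatedCode (N * p ^ s) g ↔
      ∀ x : K, x ^ N = 1 → rootMult g x + rootMult g x⁻¹ ≤ p ^ s := by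
  have hps : 0 < p ^ s := pow_pos (Fact.out : p.Prime).pos s
  have hn : 0 < N * p ^ s := by positivity
  have hg0 := ne_zero_of_dvd_X_pow_sub_one hn hg
  have hr0 : g.reverse ≠ 0 := by rwa [Ne, reverse_eq_zero]
  have hx0 {x : K} (hx : x ^ N = 1) : x ≠ 0 := by
    rintro rfl
    simp [hN.ne'] at hx
  rw [dualCode_generatedCode_le_iff hn hg]
  classical
  constructor
  · intro h x hx
    have h₁ := rootMult_le_of_dvd_X_pow_sub_one p hN hβ h x
    rwa [if_pos hx, rootMult_mul hg0 hr0, rootMult_reverse g (hx0 hx)] at h₁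
  · intro h
    have hrd : g.reverse ∣ X ^ (N * p ^ s) - 1 := by
      obtain ⟨u, hu⟩ := hg
      rw [← dvd_neg, ← reverse_X_pow_sub_one, hu, reverse_mul_of_domain]
      exact dvd_mul_right _ _
    refine dvd_X_pow_sub_one_of_rootMult_le p hN hβ (mul_ne_zero hg0 hr0) ?_ fun x => ?_
    · rw [Polynomial.map_mul]
      exact (splits_of_dvd_X_pow_sub_one p hN hβ hg).mul (splits_of_dvd_X_pow_sub_one p hN hβ hrd)
    rw [rootMult_mul hg0 hr0]
    split_ifs with hx
    · rw [rootMult_reverse g (hx0 hx)]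
      exact h x hx
    · have h₁ := rootMult_le_of_dvd_X_pow_sub_one p hN hβ hg x
      have h₂ := rootMult_le_of_dvd_X_pow_sub_one p hN hβ hrd x
      rw [if_neg hx] at h₁ h₂
      omega

end PrimitiveRoot

section Frobenius

theorem minpoly_dvd_X_pow_sub_one {y : K} {N : ℕ} (hy : y ^ N = 1) :
    minpoly F y ∣ X ^ N - 1 :=
  minpoly.dvd F y (by simp [hy])

variable [Fintype F]

theorem mem_range_algebraMap_of_pow_card {x : K} (hx : x ^ Fintype.card F = x) :
    ∃ y : F, algebraMap F K y = x := by
  have hroots := FiniteField.roots_X_pow_card_sub_X F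
  have hs : (X ^ Fintype.card F - X : F[X]).Splits := by
    rw [splits_iff_card_roots, hroots,
      FiniteField.X_pow_card_sub_X_natDegree_eq F Fintype.one_lt_card]
    rfl
  have h := hs.roots_map (algebraMap F K)
  have hmem : x ∈ ((X ^ Fintype.card F - X : F[X]).map (algebraMap F K)).roots := by
    have h0 := FiniteField.X_pow_card_sub_X_ne_zero K (Fintype.one_lt_card (α := F))
    simp only [Polynomial.map_sub, Polynomial.map_pow, map_X]
    rw [mem_roots h0]
    simp [hx]
  rw [h, Multiset.mem_map] at hmem
  obtain ⟨y, -, hy⟩ := hmem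
  exact ⟨y, hy⟩

theorem map_frobenius_map (g : F[X]) :
    (g.map (algebraMap F K)).map (FiniteField.frobeniusAlgHom F K : K →+* K) =
      g.map (algebraMap F K) := by
  rw [Polynomial.map_map]
  congr 1
  exact (FiniteField.frobeniusAlgHom F K).comp_algebraMap

theorem rootMult_pow_card (g : F[X]) (x : K) :
    rootMult g (x ^ Fintype.card F) = rootMult g x := by
  have h := eq_rootMultiplicity_map (p := g.map (algebraMap F K))
    (f := (FiniteField.frobeniusAlgHom F K : K →+* K)) (RingHom.injective _) x
  rw [map_frobenius_map] at h
  exact h.symm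

theorem rootMult_pow_card_pow (g : F[X]) (x : K) (m : ℕ) :
    rootMult g (x ^ Fintype.card F ^ m) = rootMult g x := by
  induction m with
  | zero => rw [pow_zero, pow_one]
  | succ m ih => rw [pow_succ, pow_mul, rootMult_pow_card, ih]

/-- The conjugates of a root of unity over a finite field are its iterated Frobenius powers. -/
theorem exists_pow_of_isRoot_minpoly {y : K} {N : ℕ} (hN : 0 < N) (hy : y ^ N = 1) {x : K}
    (hx : ((minpoly F y).map (algebraMap F K)).IsRoot x) :
    ∃ m : ℕ, x = y ^ Fintype.card F ^ m := by
  classical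
  set q := Fintype.card F
  let φ : K →+* K := (FiniteField.frobeniusAlgHom F K : K →+* K)
  have hφ (z : K) : φ z = z ^ q := rfl
  let S : Finset K := (nthRootsFinset N (1 : K)).filter fun z => ∃ m : ℕ, z = y ^ q ^ m
  have hS {z : K} : z ∈ S ↔ ∃ m : ℕ, z = y ^ q ^ m := by
    rw [Finset.mem_filter, mem_nthRootsFinset hN, and_iff_right_iff_imp]
    rintro ⟨m, rfl⟩
    rw [← pow_mul, mul_comm, pow_mul, hy, one_pow]
  have himage : S.image φ = S := by
    refine Finset.eq_of_subset_of_card_le (fun z hz => ?_) ?_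
    · obtain ⟨w, hw, rfl⟩ := Finset.mem_image.1 hz
      obtain ⟨m, rfl⟩ := hS.1 hw
      exact hS.2 ⟨m + 1, by rw [hφ, ← pow_mul, pow_succ]⟩
    · rw [Finset.card_image_of_injective _ φ.injective]
  let Q : K[X] := ∏ z ∈ S, (X - C z)
  have hQ : Q.map φ = Q := by
    simp only [Q, Polynomial.map_prod, Polynomial.map_sub, map_X, map_C]
    conv_rhs => rw [← himage]
    rw [Finset.prod_image fun _ _ _ _ h => φ.injective h]
  have hlift : Q ∈ lifts (algebraMap F K) := by
    rw [lifts_iff_coeff_lifts]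
    intro k
    refine mem_range_algebraMap_of_pow_card ?_
    have h := congrArg (fun f => coeff f k) hQ
    simpa only [coeff_map, hφ] using h
  obtain ⟨g, hg⟩ := (mem_lifts Q).1 hlift
  have hroot : aeval y g = 0 := by
    rw [← eval_map_algebraMap, hg, eval_prod]
    exact Finset.prod_eq_zero (i := y) (hS.2 ⟨0, by simp⟩) (by simp)
  have hxQ : IsRoot Q x := by
    rw [← hg]
    exact hx.dvd (Polynomial.map_dvd (algebraMap F K) (minpoly.dvd F y hroot))
  rw [IsRoot, eval_prod, Finset.prod_eq_zero_iff] at hxQ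
  obtain ⟨z, hz, hzx⟩ := hxQ
  have : x = z := by simpa [sub_eq_zero] using hzx
  exact this ▸ hS.1 hz

open Classical in
theorem rootMult_minpoly {β : K} {N : ℕ} (hN : 0 < N) (hβ : IsPrimitiveRoot β N) {y : K}
    (hy : y ^ N = 1) (x : K) :
    rootMult (minpoly F y) x = if ∃ m : ℕ, x = y ^ Fintype.card F ^ m then 1 else 0 := by
  have hm0 : minpoly F y ≠ 0 := ne_zero_of_dvd_X_pow_sub_one hN (minpoly_dvd_X_pow_sub_one hy)
  have hm0' := (Polynomial.map_ne_zero_iff (algebraMap F K).injective).2 hm0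
  have hself : 1 ≤ rootMult (minpoly F y) y := by
    rw [rootMult, Nat.one_le_iff_ne_zero, ← Nat.pos_iff_ne_zero, rootMultiplicity_pos hm0', IsRoot,
      eval_map_algebraMap]
    exact minpoly.aeval F y
  split_ifs with h
  · obtain ⟨m, rfl⟩ := h
    rw [rootMult_pow_card_pow]
    refine le_antisymm ?_ hself
    have : Fact (ringChar F).Prime := ⟨CharP.char_is_prime F _⟩
    have h₁ := rootMult_le_of_dvd_X_pow_sub_one (F := F) (s := 0) (ringChar F) hN hβ
      (g := minpoly F y) (by simpa using minpoly_dvd_X_pow_sub_one hy) y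
    rwa [if_pos hy, pow_zero] at h₁
  · rw [rootMult, rootMultiplicity_eq_zero_iff]
    exact fun hr => absurd (exists_pow_of_isRoot_minpoly hN hy hr) h

end Frobenius

end RootMult

section TwoPowers

theorem exists_odd_pow_two_pow {x c : ℤ} {n : ℕ} (hn : 2 ≤ n) (hc : Odd c)
    (hx : x = 1 + 2 ^ n * c) (m : ℕ) : ∃ c' : ℤ, Odd c' ∧ x ^ 2 ^ m = 1 + 2 ^ (n + m) * c' := by
  induction m with
  | zero => exact ⟨c, hc, by simpa using hx⟩
  | succ m ih =>
    obtain ⟨d, hd, h⟩ := ih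
    refine ⟨d + 2 ^ (n + m - 1) * d ^ 2, hd.add_even ?_, ?_⟩
    · exact ((even_two).pow_of_ne_zero (by omega)).mul_right _
    · have h₁ : (2 : ℤ) ^ (n + m) = 2 * 2 ^ (n + m - 1) := by
        rw [← pow_succ']; congr 1; omega
      rw [pow_succ, pow_mul, h, ← add_assoc, pow_succ _ (n + m), h₁]
      ring

theorem orderOf_intCast_zmod_two_pow {x c : ℤ} {n : ℕ} (hn : 2 ≤ n) (hc : Odd c)
    (hx4 : x ≡ -1 [ZMOD 4]) (hx : x ^ 2 = 1 + 2 ^ n * c) (m : ℕ) :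
    orderOf (x : ZMod (2 ^ (n + m))) = 2 ^ (m + 1) := by
  have hone (k e : ℕ) : (x : ZMod (2 ^ e)) ^ k = 1 ↔ (2 : ℤ) ^ e ∣ x ^ k - 1 := by
    rw [← sub_eq_zero]
    have h := ZMod.intCast_zmod_eq_zero_iff_dvd (x ^ k - 1) (2 ^ e)
    push_cast at h
    exact h
  have hsq : orderOf ((x : ZMod (2 ^ (n + m))) ^ 2) = 2 ^ m := by
    cases m with
    | zero =>
      rw [pow_zero, orderOf_eq_one_iff, hone, hx]
      exact ⟨c, by simp⟩
    | succ m =>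
      have : Fact (Nat.Prime 2) := ⟨Nat.prime_two⟩
      refine orderOf_eq_prime_pow ?_ ?_
      · obtain ⟨d, hd, h⟩ := exists_odd_pow_two_pow hn hc hx m
        rw [← pow_mul, hone, pow_mul, h, add_sub_cancel_left, ← add_assoc, pow_succ (2 : ℤ) (n + m),
          mul_dvd_mul_iff_left (by positivity)]
        rwa [← even_iff_two_dvd, Int.not_even_iff_odd]
      · obtain ⟨d, hd, h⟩ := exists_odd_pow_two_pow hn hc hx (m + 1)
        rw [← pow_mul, hone, pow_mul, h, add_sub_cancel_left]
        exact dvd_mul_right _ _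
  have heven : 2 ∣ orderOf (x : ZMod (2 ^ (n + m))) := by
    rw [← even_iff_two_dvd]
    by_contra hodd
    rw [Nat.not_even_iff_odd] at hodd
    have h := (hone _ _).1 (pow_orderOf_eq_one (x : ZMod (2 ^ (n + m))))
    have h4 : (4 : ℤ) ∣ x ^ orderOf (x : ZMod (2 ^ (n + m))) - 1 :=
      (pow_dvd_pow (2 : ℤ) (by omega : 2 ≤ n + m)).trans h
    have h₁ := hx4.pow (orderOf (x : ZMod (2 ^ (n + m))))
    rw [hodd.neg_one_pow] at h₁
    have h₂ := h₁.symm.dvd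
    omega
  rw [orderOf_pow_of_dvd two_ne_zero heven] at hsq
  obtain ⟨k, hk⟩ := heven
  rw [hk] at hsq ⊢
  rw [Nat.mul_div_cancel_left _ two_pos] at hsq
  rw [hsq, pow_succ']

theorem three_pow_mod_eight (k : ℕ) : (3 : ℤ) ^ k % 8 = 1 ∨ (3 : ℤ) ^ k % 8 = 3 := by
  induction k with
  | zero => simp
  | succ k ih => rw [pow_succ]; omega

theorem eq_of_three_pow_modEq {i k l : ℕ} (hk : k < 2 ^ (i - 2)) (hl : l < 2 ^ (i - 2))
    (h : (3 : ℤ) ^ k ≡ 3 ^ l [ZMOD 2 ^ i] ∨ (3 : ℤ) ^ k ≡ -3 ^ l [ZMOD 2 ^ i]) : k = l := by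
  rcases Nat.lt_or_ge i 3 with hi | hi
  · have : i - 2 = 0 := by omega
    rw [this, pow_zero] at hk hl
    omega
  have h8 : (8 : ℤ) ∣ 2 ^ i := pow_dvd_pow (2 : ℤ) hi
  have h : (3 : ℤ) ^ k ≡ 3 ^ l [ZMOD 2 ^ i] := by
    refine h.resolve_right fun h' => ?_
    have h₁ := (h'.of_dvd h8).symm.dvd
    have h₂ := three_pow_mod_eight k
    have h₃ := three_pow_mod_eight l
    omega
  obtain ⟨m, rfl⟩ := Nat.exists_eq_add_of_le hi
  have hord := orderOf_intCast_zmod_two_pow (x := 3) (c := 1) (n := 3) (by norm_num)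
    odd_one (by decide) (by norm_num) m
  have h₁ : ((3 : ℤ) : ZMod (2 ^ (3 + m))) ^ k = ((3 : ℤ) : ZMod (2 ^ (3 + m))) ^ l := by
    have h₂ := (ZMod.intCast_eq_intCast_iff (3 ^ k) (3 ^ l) (2 ^ (3 + m))).2 (by exact_mod_cast h)
    exact_mod_cast h₂
  have hexp : 3 + m - 2 = m + 1 := by omega
  rw [hexp, ← hord] at hk hl
  exact pow_injOn_Iio_orderOf hk hl h₁

variable {a b q : ℕ}

theorem modEq_neg_one_of_eq (hq : (q : ℤ) = 2 ^ a * b - 1) {i : ℕ} (hi : i ≤ a) :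
    (q : ℤ) ≡ -1 [ZMOD 2 ^ i] := by
  rw [Int.modEq_comm, Int.modEq_iff_dvd, hq]
  obtain ⟨c, hc⟩ := pow_dvd_pow (2 : ℤ) hi
  exact ⟨c * b, by rw [hc]; ring⟩

theorem pow_modEq_of_le (hq : (q : ℤ) = 2 ^ a * b - 1) {i : ℕ} (hi : i ≤ a) (m : ℕ) :
    (q : ℤ) ^ m ≡ 1 [ZMOD 2 ^ i] ∨ (q : ℤ) ^ m ≡ -1 [ZMOD 2 ^ i] := by
  have h := (modEq_neg_one_of_eq hq hi).pow m
  rcases neg_one_pow_eq_or ℤ m with h₁ | h₁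
  · exact Or.inl (h₁ ▸ h)
  · exact Or.inr (h₁ ▸ h)

theorem sq_eq_of_eq (hq : (q : ℤ) = 2 ^ a * b - 1) (ha : 2 ≤ a) :
    (q : ℤ) ^ 2 = 1 + 2 ^ (a + 1) * (2 ^ (a - 1) * b ^ 2 - b) := by
  have h : (2 : ℤ) ^ a = 2 * 2 ^ (a - 1) := by rw [← pow_succ']; congr 1; omega
  rw [hq, pow_succ (2 : ℤ) a, h]
  ring

theorem not_pow_modEq_neg_one (ha : 2 ≤ a) (hb : Odd b) (hq : (q : ℤ) = 2 ^ a * b - 1) {i : ℕ}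
    (hi : a < i) (m : ℕ) : ¬ (q : ℤ) ^ m ≡ -1 [ZMOD 2 ^ i] := by
  intro h
  have h := h.of_dvd (pow_dvd_pow (2 : ℤ) (show a + 1 ≤ i from hi))
  have hsq : (q : ℤ) ^ 2 ≡ 1 [ZMOD 2 ^ (a + 1)] := by
    rw [Int.modEq_comm, Int.modEq_iff_dvd, sq_eq_of_eq hq ha, add_sub_cancel_left]
    exact dvd_mul_right _ _
  have h4 : (4 : ℤ) ∣ 2 ^ (a + 1) := pow_dvd_pow (2 : ℤ) (show 2 ≤ a + 1 by omega)
  rcases Nat.even_or_odd' m with ⟨k, rfl | rfl⟩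
  · have h₁ := hsq.pow k
    rw [← pow_mul, one_pow] at h₁
    have h₂ := ((h₁.symm.trans h).of_dvd h4).dvd
    omega
  · have h₁ := (hsq.pow k).mul_right q
    rw [← pow_mul, one_pow, one_mul, ← pow_succ] at h₁
    have h₂ := (h₁.symm.trans h).symm.dvd
    rw [hq, sub_neg_eq_add, sub_add_cancel, pow_succ, mul_dvd_mul_iff_left (by positivity)] at h₂
    obtain ⟨c, rfl⟩ := hb
    omega

end TwoPowers

section Representatives

/-- Representatives of the cosets of `⟨2 ^ a * b - 1⟩` in the odd residues modulo `2 ^ i`. -/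
def oddReps (a i : ℕ) : Finset ℤ :=
  if i ≤ a then (Finset.range (2 ^ (i - 2))).image (fun k => (3 : ℤ) ^ k)
  else (Finset.range (2 ^ (a - 2))).image (fun k => (3 : ℤ) ^ k) ∪
    (Finset.range (2 ^ (a - 2))).image (fun k => -(3 : ℤ) ^ k)

variable {a b q i r : ℕ}

theorem oddReps_of_three_le (ha : 2 ≤ a) (hi : 3 ≤ i) : oddReps a i = O a i := by
  unfold oddReps O
  by_cases h2 : a = 2
  · subst h2
    rw [if_neg (by omega), if_pos rfl]
    rfl
  · rw [if_neg h2]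

theorem oddReps_of_le_two (ha : 2 ≤ a) (hi : i ≤ 2) : oddReps a i = {1} := by
  rw [oddReps, if_pos (by omega), Nat.sub_eq_zero_of_le hi]
  rfl

theorem mem_oddReps_of_le (h : i ≤ a) {t : ℤ} :
    t ∈ oddReps a i ↔ ∃ k < 2 ^ (i - 2), (3 : ℤ) ^ k = t := by
  simp [oddReps, if_pos h]

theorem mem_oddReps_of_lt (h : a < i) {t : ℤ} :
    t ∈ oddReps a i ↔ ∃ k < 2 ^ (a - 2), t = (3 : ℤ) ^ k ∨ t = -(3 : ℤ) ^ k := by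
  simp only [oddReps, if_neg h.not_ge, Finset.mem_union, Finset.mem_image, Finset.mem_range]
  constructor
  · rintro (⟨k, hk, rfl⟩ | ⟨k, hk, rfl⟩)
    exacts [⟨k, hk, Or.inl rfl⟩, ⟨k, hk, Or.inr rfl⟩]
  · rintro ⟨k, hk, rfl | rfl⟩
    exacts [Or.inl ⟨k, hk, rfl⟩, Or.inr ⟨k, hk, rfl⟩]

theorem odd_of_mem_oddReps {t : ℤ} (ht : t ∈ oddReps a i) : Odd t := by
  have h3 (k : ℕ) : Odd ((3 : ℤ) ^ k) := Odd.pow (by decide)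
  rcases le_or_gt i a with h | h
  · obtain ⟨k, -, rfl⟩ := (mem_oddReps_of_le h).1 ht
    exact h3 k
  · obtain ⟨k, -, rfl | rfl⟩ := (mem_oddReps_of_lt h).1 ht
    exacts [h3 k, (h3 k).neg]

theorem three_pow_injective : Function.Injective fun k : ℕ => (3 : ℤ) ^ k :=
  pow_right_injective₀ (by norm_num) (by norm_num)

theorem card_oddReps_of_le (h : i ≤ a) : (oddReps a i).card = 2 ^ (i - 2) := by
  rw [oddReps, if_pos h, Finset.card_image_of_injective _ three_pow_injective, Finset.card_range]

theorem card_oddReps_of_lt (ha : 2 ≤ a) (h : a < i) : (oddReps a i).card = 2 ^ (a - 1) := by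
  rw [oddReps, if_neg h.not_ge, Finset.card_union_of_disjoint,
    Finset.card_image_of_injective _ three_pow_injective,
    Finset.card_image_of_injective _ fun k l h => three_pow_injective (neg_injective h),
    Finset.card_range, ← two_mul, ← pow_succ']
  · congr 1; omega
  · rw [Finset.disjoint_left]
    simp only [Finset.mem_image, Finset.mem_range]
    rintro x ⟨k, -, rfl⟩ ⟨l, -, h⟩
    have h₁ : (0 : ℤ) < 3 ^ k := by positivity
    have h₂ : (0 : ℤ) < 3 ^ l := by positivity
    omega

/-- The order of `2 ^ a * b - 1` modulo `2 ^ i`. -/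
def cosetSize (a i : ℕ) : ℕ := if i ≤ 1 then 1 else if i ≤ a then 2 else 2 ^ (i - a)

theorem card_oddReps_mul_cosetSize (ha : 2 ≤ a) (hi : 1 ≤ i) :
    (oddReps a i).card * cosetSize a i = 2 ^ (i - 1) := by
  unfold cosetSize
  split_ifs with h₁ h₂
  · obtain rfl : i = 1 := by omega
    rw [card_oddReps_of_le (by omega)]
    rfl
  · rw [card_oddReps_of_le h₂, ← pow_succ]
    congr 1; omega
  · rw [card_oddReps_of_lt ha (by omega), ← pow_add]
    congr 1; omega

theorem sum_card_oddReps_mul_cosetSize (ha : 2 ≤ a) (r : ℕ) :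
    ∑ i ∈ Finset.Icc 1 r, (oddReps a i).card * cosetSize a i + 1 = 2 ^ r := by
  induction r with
  | zero => simp
  | succ r ih =>
    rw [Finset.sum_Icc_succ_top (by omega), card_oddReps_mul_cosetSize ha (by omega),
      Nat.add_sub_cancel, add_right_comm, ih, pow_succ]
    ring

theorem orderOf_eq_cosetSize (ha : 2 ≤ a) (hb : Odd b) (hq : (q : ℤ) = 2 ^ a * b - 1) (i : ℕ) :
    orderOf (q : ZMod (2 ^ i)) = cosetSize a i := by
  have hneg (h : i ≤ a) : (q : ZMod (2 ^ i)) = -1 := by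
    have h₁ := (ZMod.intCast_eq_intCast_iff (q : ℤ) (-1) (2 ^ i)).2
      (by exact_mod_cast modEq_neg_one_of_eq hq h)
    exact_mod_cast h₁
  unfold cosetSize
  split_ifs with h₁ h₂
  · rw [orderOf_eq_one_iff, hneg (by omega)]
    interval_cases i <;> rfl
  · have : Fact (1 < 2 ^ i) := ⟨Nat.one_lt_two_pow (by omega)⟩
    rw [hneg h₂, orderOf_neg_one, ringChar.eq_iff.2 (ZMod.charP (2 ^ i)), if_neg]
    intro h
    have h₃ : 2 ^ 2 ≤ 2 ^ i := Nat.pow_le_pow_right two_pos (by omega)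
    omega
  · obtain ⟨m, rfl⟩ := Nat.exists_eq_add_of_le (show a + 1 ≤ i by omega)
    have h := orderOf_intCast_zmod_two_pow (x := q) (n := a + 1) (by omega) ?_
      (modEq_neg_one_of_eq hq ha) (sq_eq_of_eq hq ha) m
    · rw [Int.cast_natCast] at h
      rw [h]
      congr 1; omega
    · refine Even.sub_odd ?_ (by exact_mod_cast hb)
      exact (even_two.pow_of_ne_zero (by omega)).mul_right _

/-- Distinct elements of `oddReps a i` lie in different cosets. -/
theorem eq_of_mem_oddReps_of_modEq (ha : 2 ≤ a) (hb : Odd b) (hq : (q : ℤ) = 2 ^ a * b - 1)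
    {t t' : ℤ} (ht : t ∈ oddReps a i) (ht' : t' ∈ oddReps a i) {m : ℕ}
    (h : t ≡ t' * q ^ m [ZMOD 2 ^ i]) : t = t' := by
  rcases le_or_gt i a with hi | hi
  · obtain ⟨k, hk, rfl⟩ := (mem_oddReps_of_le hi).1 ht
    obtain ⟨l, hl, rfl⟩ := (mem_oddReps_of_le hi).1 ht'
    rw [eq_of_three_pow_modEq hk hl]
    rcases pow_modEq_of_le hq hi m with h₁ | h₁
    · left; simpa using h.trans (h₁.mul_left (3 ^ l))
    · right; simpa using h.trans (h₁.mul_left (3 ^ l))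
  · have hsign {t : ℤ} {k : ℕ} (h : t = 3 ^ k ∨ t = -3 ^ k) :
        (3 : ℤ) ^ k = t ∨ (3 : ℤ) ^ k = -t := by
      rcases h with rfl | rfl
      exacts [Or.inl rfl, Or.inr (neg_neg _).symm]
    obtain ⟨k, hk, hkt⟩ := (mem_oddReps_of_lt hi).1 ht
    obtain ⟨l, hl, hlt⟩ := (mem_oddReps_of_lt hi).1 ht'
    have hmod : t ≡ t' [ZMOD 2 ^ a] ∨ t ≡ -t' [ZMOD 2 ^ a] := by
      have h' := h.of_dvd (pow_dvd_pow (2 : ℤ) hi.le)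
      rcases pow_modEq_of_le hq le_rfl m with h₁ | h₁
      · left; simpa using h'.trans (h₁.mul_left t')
      · right; simpa using h'.trans (h₁.mul_left t')
    have hkl : k = l := by
      apply eq_of_three_pow_modEq hk hl
      have hneg : t ≡ -t' [ZMOD 2 ^ a] ↔ -t ≡ t' [ZMOD 2 ^ a] :=
        ⟨fun h => by simpa using h.neg, fun h => by simpa using h.neg⟩
      rcases hsign hkt with h₁ | h₁ <;> rcases hsign hlt with h₂ | h₂ <;> rw [h₁, h₂]
      · exact hmod
      · rw [neg_neg]; exact hmod.symm
      · rw [← hneg, Int.neg_modEq_neg]; exact hmod.symm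
      · rw [neg_neg, ← hneg, Int.neg_modEq_neg]; exact hmod
    have htt : t = t' ∨ t = -t' := by
      subst hkl
      rcases hkt with rfl | rfl <;> rcases hlt with rfl | rfl <;> simp
    refine htt.resolve_right fun htt => ?_
    have hcop : IsCoprime ((2 : ℤ) ^ i) t' := by
      obtain ⟨k, hk⟩ := odd_of_mem_oddReps ht'
      exact IsCoprime.pow_left ⟨-k, 1, by rw [hk]; ring⟩
    refine not_pow_modEq_neg_one ha hb hq hi m ?_
    rw [htt, Int.modEq_iff_dvd] at h
    rw [Int.modEq_comm, Int.modEq_iff_dvd]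
    refine hcop.dvd_of_dvd_mul_left (?_ : _ ∣ t' * _)
    convert h using 1
    ring

theorem odd_of_eq (ha : 2 ≤ a) (hq : (q : ℤ) = 2 ^ a * b - 1) : Odd (q : ℤ) := by
  rw [hq]
  exact ((even_two.pow_of_ne_zero (by omega)).mul_right _).sub_odd odd_one

theorem le_of_mul_two_pow_modEq {i i' m : ℕ} {t t' : ℤ} (hi' : i' ≤ r)
    (ht' : Odd t') (hq : Odd (q : ℤ))
    (h : t * 2 ^ (r - i) ≡ t' * 2 ^ (r - i') * q ^ m [ZMOD 2 ^ r]) :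
    i' ≤ i := by
  by_contra! hlt
  have h₁ : (2 : ℤ) ^ (r - i' + 1) ∣ t' * 2 ^ (r - i') * q ^ m := by
    have h₂ := h.of_dvd (pow_dvd_pow (2 : ℤ) (show r - i' + 1 ≤ r by omega))
    rw [← h₂.dvd_iff]
    exact (pow_dvd_pow (2 : ℤ) (by omega)).mul_left t
  rw [mul_right_comm, mul_comm, pow_succ, mul_dvd_mul_iff_left (by positivity)] at h₁
  rw [← even_iff_two_dvd, ← Int.not_odd_iff_even] at h₁
  exact h₁ (ht'.mul hq.pow)

theorem modEq_of_mul_two_pow_modEq {m : ℕ} {t t' : ℤ} (hi : i ≤ r)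
    (h : t * 2 ^ (r - i) ≡ t' * 2 ^ (r - i) * q ^ m [ZMOD 2 ^ r]) :
    t ≡ t' * q ^ m [ZMOD 2 ^ i] := by
  have hr : (2 : ℤ) ^ r = 2 ^ i * 2 ^ (r - i) := by rw [← pow_add]; congr 1; omega
  rw [hr, mul_right_comm] at h
  exact Int.ModEq.mul_right_cancel' (by positivity) h

theorem T_eq (ha : 2 ≤ a) (hr : 2 ≤ r) : T a r = insert 0 ((Finset.Icc 1 r).biUnion fun i =>
    (oddReps a i).image fun t => t * 2 ^ (r - i)) := by
  have h : Finset.Icc 1 r = insert 1 (insert 2 (Finset.Icc 3 r)) := by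
    ext i; simp only [Finset.mem_Icc, Finset.mem_insert]; omega
  have h3 : (Finset.Icc 3 r).biUnion (fun i => (oddReps a i).image fun t => t * 2 ^ (r - i)) =
      (Finset.Icc 3 r).biUnion (fun i => (O a i).image fun t => t * 2 ^ (r - i)) :=
    Finset.biUnion_congr rfl fun i hi => by
      rw [oddReps_of_three_le ha (Finset.mem_Icc.1 hi).1]
  rw [h, Finset.biUnion_insert, Finset.biUnion_insert, h3, oddReps_of_le_two ha (by norm_num),
    oddReps_of_le_two ha le_rfl, T]
  ext x
  simp only [Finset.mem_union, Finset.mem_insert, Finset.image_singleton, Finset.mem_singleton,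
    one_mul]
  tauto

theorem mem_T (ha : 2 ≤ a) (hr : 2 ≤ r) {h : ℤ} :
    h ∈ T a r ↔ h = 0 ∨ ∃ i ∈ Finset.Icc 1 r, ∃ t ∈ oddReps a i, t * 2 ^ (r - i) = h := by
  rw [T_eq ha hr]
  simp only [Finset.mem_insert, Finset.mem_biUnion, Finset.mem_image]

/-- The elements of `T a r` lie in pairwise different cyclotomic cosets. -/
theorem eq_of_mem_T_of_modEq (ha : 2 ≤ a) (hb : Odd b) (hq : (q : ℤ) = 2 ^ a * b - 1)
    (hr : 2 ≤ r) {h h' : ℤ} (hh : h ∈ T a r) (hh' : h' ∈ T a r) {m : ℕ}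
    (hmod : h ≡ h' * q ^ m [ZMOD 2 ^ r]) : h = h' := by
  have hqo := odd_of_eq ha hq
  rw [mem_T ha hr] at hh hh'
  obtain rfl | ⟨i, hi, t, ht, rfl⟩ := hh <;> obtain rfl | ⟨i', hi', t', ht', rfl⟩ := hh'
  · rfl
  · rw [Finset.mem_Icc] at hi'
    have h₁ := le_of_mul_two_pow_modEq (i := 0) (t := 0) hi'.2 (odd_of_mem_oddReps ht') hqo
      (by simpa using hmod)
    omega
  · rw [Finset.mem_Icc] at hi
    have h₁ := le_of_mul_two_pow_modEq (q := q) (i := 0) (t := 0) (m := 0) hi.2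
      (odd_of_mem_oddReps ht) hqo (by simpa using hmod.symm)
    omega
  · rw [Finset.mem_Icc] at hi hi'
    have h₁ := le_of_mul_two_pow_modEq hi'.2 (odd_of_mem_oddReps ht') hqo hmod
    have h₂ : i ≤ i' := by
      have h₃ : t' * q ^ m * 2 ^ (r - i') ≡ t * 2 ^ (r - i) * q ^ 0 [ZMOD 2 ^ r] := by
        rw [pow_zero, mul_one, mul_right_comm]; exact hmod.symm
      exact le_of_mul_two_pow_modEq hi.2 (odd_of_mem_oddReps ht) hqo h₃
    obtain rfl : i = i' := le_antisymm h₂ h₁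
    rw [eq_of_mem_oddReps_of_modEq ha hb hq ht ht' (modEq_of_mul_two_pow_modEq hi.2 hmod)]

end Representatives

section Index

variable {a q i i' r : ℕ}

theorem eq_of_mul_two_pow_eq {t t' : ℤ} (ht : Odd t) (ht' : Odd t') (hi : i ≤ r) (hi' : i' ≤ r)
    (h : t * 2 ^ (r - i) = t' * 2 ^ (r - i')) : i = i' := by
  refine le_antisymm ?_ ?_
  · refine le_of_mul_two_pow_modEq (r := r) (q := 1) (m := 0) hi ht (by simp) (t := t') ?_
    rw [h, pow_zero, mul_one]
  · refine le_of_mul_two_pow_modEq (r := r) (q := 1) (m := 0) hi' ht' (by simp) (t := t) ?_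
    rw [h, pow_zero, mul_one]

theorem disjoint_image_mul_two_pow {S S' : Finset ℤ} (hS : ∀ t ∈ S, Odd t) (hS' : ∀ t ∈ S', Odd t)
    (hi : i ≤ r) (hi' : i' ≤ r) (hne : i ≠ i') :
    Disjoint (S.image fun t => t * 2 ^ (r - i)) (S'.image fun t => t * 2 ^ (r - i')) := by
  rw [Finset.disjoint_left]
  intro x hx hx'
  obtain ⟨t, ht, rfl⟩ := Finset.mem_image.1 hx
  obtain ⟨t', ht', h⟩ := Finset.mem_image.1 hx'
  exact hne (eq_of_mul_two_pow_eq (hS t ht) (hS' t' ht') hi hi' h.symm)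

theorem mul_two_pow_injective (k : ℕ) : Function.Injective fun t : ℤ => t * 2 ^ k :=
  mul_left_injective₀ (by positivity)

theorem zero_notMem_biUnion_image {I : Finset ℕ} {S : ℕ → Finset ℤ}
    (hS : ∀ i, ∀ t ∈ S i, Odd t) :
    (0 : ℤ) ∉ I.biUnion fun i => (S i).image fun t => t * 2 ^ (r - i) := by
  simp only [Finset.mem_biUnion, Finset.mem_image, not_exists, not_and]
  intro i _ t ht h
  have h₁ : t = 0 := by simpa using h
  exact absurd (hS i t ht) (by rw [h₁]; decide)

theorem pairwiseDisjoint_image {I : Finset ℕ} {S : ℕ → Finset ℤ} (hI : ∀ i ∈ I, i ≤ r)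
    (hS : ∀ i, ∀ t ∈ S i, Odd t) :
    (I : Set ℕ).PairwiseDisjoint fun i => (S i).image fun t => t * 2 ^ (r - i) :=
  fun i hi i' hi' hne => disjoint_image_mul_two_pow (hS i) (hS i') (hI i hi) (hI i' hi') hne

@[to_additive]
theorem prod_T_eq_prod_oddReps {M : Type*} [CommMonoid M] (ha : 2 ≤ a) (hr : 2 ≤ r) (f : ℤ → M) :
    ∏ h ∈ T a r, f h =
      f 0 * ∏ i ∈ Finset.Icc 1 r, ∏ t ∈ oddReps a i, f (t * 2 ^ (r - i)) := by
  rw [T_eq ha hr, Finset.prod_insert (zero_notMem_biUnion_image fun i t => odd_of_mem_oddReps),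
    Finset.prod_biUnion
      (pairwiseDisjoint_image (fun i hi => (Finset.mem_Icc.1 hi).2) fun i t => odd_of_mem_oddReps)]
  congr 1
  exact Finset.prod_congr rfl fun i _ => Finset.prod_image fun _ _ _ _ h =>
    mul_two_pow_injective _ h

@[to_additive]
theorem prod_T {M : Type*} [CommMonoid M] (ha : 2 ≤ a) (hr : 2 ≤ r) (f : ℤ → M) :
    ∏ h ∈ T a r, f h = f 0 * f (2 ^ (r - 1)) * f (2 ^ (r - 2)) *
      ∏ i ∈ Finset.Icc 3 r, ∏ t ∈ O a i, f (t * 2 ^ (r - i)) := by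
  have h : Finset.Icc 1 r = insert 1 (insert 2 (Finset.Icc 3 r)) := by
    ext i; simp only [Finset.mem_Icc, Finset.mem_insert]; omega
  rw [prod_T_eq_prod_oddReps ha hr, h, Finset.prod_insert (by simp), Finset.prod_insert (by simp),
    oddReps_of_le_two ha (by norm_num), oddReps_of_le_two ha le_rfl, Finset.prod_singleton,
    Finset.prod_singleton, one_mul, one_mul, mul_assoc, mul_assoc]
  congr 3
  exact Finset.prod_congr rfl fun i hi => by
    rw [oddReps_of_three_le ha (Finset.mem_Icc.1 hi).1]

end Index

section Orbit

variable {K : Type*} [Field K] {N M q : ℕ}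

open Classical in
/-- The orbit of a root of unity under the powers of `x ↦ x ^ q`. -/
noncomputable def powOrbit (N q : ℕ) (y : K) : Finset K :=
  (nthRootsFinset N (1 : K)).filter fun x => ∃ m : ℕ, x = y ^ q ^ m

theorem mem_powOrbit (hN : 0 < N) {y : K} (hy : y ^ N = 1) {x : K} :
    x ∈ powOrbit N q y ↔ ∃ m : ℕ, x = y ^ q ^ m := by
  classical
  rw [powOrbit, Finset.mem_filter, mem_nthRootsFinset hN, and_iff_right_iff_imp]
  rintro ⟨m, rfl⟩
  rw [← pow_mul, mul_comm, pow_mul, hy, one_pow]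

theorem zpow_eq_zpow_iff_modEq {y : K} (hy : IsPrimitiveRoot y M) (hM : 0 < M) (h h' : ℤ) :
    y ^ h = y ^ h' ↔ h ≡ h' [ZMOD M] := by
  have h0 : y ≠ 0 := by
    rintro rfl
    have h₁ := hy.pow_eq_one
    rw [zero_pow hM.ne'] at h₁
    exact zero_ne_one h₁
  rw [← div_eq_one_iff_eq (zpow_ne_zero _ h0), ← zpow_sub₀ h0, hy.zpow_eq_one_iff_dvd,
    Int.modEq_comm, Int.modEq_iff_dvd]

theorem zpow_pow_pow (y : K) (h : ℤ) (q m : ℕ) :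
    (y ^ h) ^ q ^ m = y ^ (h * (q : ℤ) ^ m) := by
  rw [zpow_mul, ← Nat.cast_pow, zpow_natCast]

theorem card_powOrbit (hN : 0 < N) {y : K} (hy : y ^ N = 1) (hyM : IsPrimitiveRoot y M)
    (hM : 0 < M) (hq : q.Coprime M) :
    (powOrbit N q y).card = orderOf (q : ZMod M) := by
  classical
  have : NeZero M := ⟨hM.ne'⟩
  have hfin : IsOfFinOrder (q : ZMod M) :=
    ((ZMod.isUnit_iff_coprime q M).2 hq).isOfFinOrder
  have hpow (k l : ℕ) : y ^ q ^ k = y ^ q ^ l ↔ (q : ZMod M) ^ k = (q : ZMod M) ^ l := by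
    rw [← zpow_natCast, ← zpow_natCast, zpow_eq_zpow_iff_modEq hyM hM,
      ← ZMod.intCast_eq_intCast_iff]
    push_cast
    rfl
  have himage : powOrbit N q y =
      (Finset.range (orderOf (q : ZMod M))).image fun m => y ^ q ^ m := by
    ext x
    rw [mem_powOrbit hN hy, Finset.mem_image]
    constructor
    · rintro ⟨m, rfl⟩
      refine ⟨m % orderOf (q : ZMod M), Finset.mem_range.2 (Nat.mod_lt _ hfin.orderOf_pos), ?_⟩
      rw [hpow, pow_mod_orderOf]
    · rintro ⟨m, -, rfl⟩
      exact ⟨m, rfl⟩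
  rw [himage, Finset.card_image_of_injOn, Finset.card_range]
  intro k hk l hl h
  rw [Finset.coe_range] at hk hl
  exact pow_injOn_Iio_orderOf hk hl ((hpow k l).1 h)

end Orbit

/-- The standing hypotheses on `q = |F| = 2 ^ a * b - 1` and the root of unity `β`. -/
structure IsTwoPowerSetting (F : Type*) [Field F] [Fintype F] {K : Type*} [Field K] [Algebra F K]
    (β : K) (a b r : ℕ) : Prop where
  two_le_a : 2 ≤ a
  odd_b : Odd b
  two_le_r : 2 ≤ r
  card_eq : (Fintype.card F : ℤ) = 2 ^ a * b - 1
  prim : IsPrimitiveRoot β (2 ^ r)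

namespace IsTwoPowerSetting

variable {F : Type*} [Field F] [Fintype F] {K : Type*} [Field K] [Algebra F K]
  {β : K} {a b r : ℕ}

section Orbits

theorem odd_card (hS : IsTwoPowerSetting F β a b r) : Odd (Fintype.card F) := by
  exact_mod_cast odd_of_eq hS.two_le_a hS.card_eq

theorem zpow_pow_eq_one (hS : IsTwoPowerSetting F β a b r) (h : ℤ) : (β ^ h) ^ 2 ^ r = 1 := by
  rw [← zpow_natCast, zpow_comm, zpow_natCast, hS.prim.pow_eq_one, one_zpow]

theorem zpow_eq_zpow_iff (hS : IsTwoPowerSetting F β a b r) (h h' : ℤ) :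
    β ^ h = β ^ h' ↔ h ≡ h' [ZMOD 2 ^ r] := by
  simpa using zpow_eq_zpow_iff_modEq hS.prim (by positivity) h h'

theorem eq_of_mem_T (hS : IsTwoPowerSetting F β a b r) {h h' : ℤ} (hh : h ∈ T a r)
    (hh' : h' ∈ T a r) {m m' : ℕ}
    (heq : (β ^ h) ^ Fintype.card F ^ m = (β ^ h') ^ Fintype.card F ^ m') : h = h' := by
  wlog hmm : m ≤ m' generalizing h h' m m'
  · exact (this hh' hh heq.symm (le_of_not_ge hmm)).symm
  obtain ⟨k, rfl⟩ := Nat.exists_eq_add_of_le' hmm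
  have hinj : Function.Injective fun x : K => x ^ Fintype.card F ^ m := by
    have h₁ := (RingHom.injective (FiniteField.frobeniusAlgHom F K : K →+* K)).iterate m
    convert h₁ using 1
    funext x
    have h₂ : (⇑(FiniteField.frobeniusAlgHom F K : K →+* K)) = (· ^ Fintype.card F) := rfl
    rw [h₂, pow_iterate]
  rw [pow_add, pow_mul] at heq
  have h₁ : β ^ h = (β ^ h') ^ Fintype.card F ^ k := hinj heq
  rw [zpow_pow_pow, hS.zpow_eq_zpow_iff] at h₁
  exact eq_of_mem_T_of_modEq hS.two_le_a hS.odd_b hS.card_eq hS.two_le_r hh hh' h₁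

theorem isPrimitiveRoot_zpow (hS : IsTwoPowerSetting F β a b r) {i : ℕ} (hi : i ≤ r) {t : ℤ}
    (ht : Odd t) : IsPrimitiveRoot (β ^ (t * 2 ^ (r - i))) (2 ^ i) := by
  have h₁ : IsPrimitiveRoot (β ^ 2 ^ (r - i)) (2 ^ i) :=
    hS.prim.pow (by positivity) (by rw [← pow_add]; congr 1; omega)
  have h₂ : β ^ (t * 2 ^ (r - i)) = (β ^ 2 ^ (r - i)) ^ t := by
    rw [mul_comm, zpow_mul]
    norm_cast
  rw [h₂]
  refine h₁.zpow_of_gcd_eq_one t ?_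
  rw [← Int.isCoprime_iff_gcd_eq_one]
  obtain ⟨k, rfl⟩ := ht
  push_cast
  exact IsCoprime.pow_right ⟨1, -k, by ring⟩

theorem card_powOrbit_zpow (hS : IsTwoPowerSetting F β a b r) {i : ℕ} (hi : i ≤ r) {t : ℤ}
    (ht : Odd t) :
    (powOrbit (2 ^ r) (Fintype.card F) (β ^ (t * 2 ^ (r - i)))).card = cosetSize a i := by
  rw [card_powOrbit (by positivity) (hS.zpow_pow_eq_one _) (hS.isPrimitiveRoot_zpow hi ht)
    (by positivity) (hS.odd_card.coprime_two_right.pow_right i)]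
  exact orderOf_eq_cosetSize hS.two_le_a hS.odd_b hS.card_eq i

theorem card_powOrbit_one (hS : IsTwoPowerSetting F β a b r) :
    (powOrbit (2 ^ r) (Fintype.card F) (β ^ (0 : ℤ))).card = 1 := by
  rw [Finset.card_eq_one]
  refine ⟨1, Finset.ext fun x => ?_⟩
  rw [mem_powOrbit (by positivity) (hS.zpow_pow_eq_one 0)]
  simp

theorem sum_card_powOrbit (hS : IsTwoPowerSetting F β a b r) :
    ∑ h ∈ T a r, (powOrbit (2 ^ r) (Fintype.card F) (β ^ h)).card = 2 ^ r := by
  refine Eq.trans ?_ (sum_card_oddReps_mul_cosetSize hS.two_le_a r)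
  rw [sum_T_eq_sum_oddReps hS.two_le_a hS.two_le_r, hS.card_powOrbit_one, add_comm]
  congr 1
  refine Finset.sum_congr rfl fun i hi => ?_
  rw [Finset.sum_congr rfl fun t ht =>
    hS.card_powOrbit_zpow (Finset.mem_Icc.1 hi).2 (odd_of_mem_oddReps ht), Finset.sum_const,
    smul_eq_mul]

/-- The elements of `T a r` represent all cyclotomic cosets. -/
theorem exists_mem_T (hS : IsTwoPowerSetting F β a b r) {x : K} (hx : x ^ 2 ^ r = 1) :
    ∃ h ∈ T a r, ∃ m : ℕ, x = (β ^ h) ^ Fintype.card F ^ m := by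
  classical
  have hN : 0 < 2 ^ r := by positivity
  have hunion : (T a r).biUnion (fun h => powOrbit (2 ^ r) (Fintype.card F) (β ^ h)) =
      nthRootsFinset (2 ^ r) (1 : K) := by
    refine Finset.eq_of_subset_of_card_le ?_ ?_
    · exact Finset.biUnion_subset.2 fun h _ => Finset.filter_subset _ _
    · rw [hS.prim.card_nthRootsFinset, Finset.card_biUnion, hS.sum_card_powOrbit]
      intro h hh h' hh' hne
      refine Finset.disjoint_left.2 fun y => ?_
      intro hy hy'
      rw [mem_powOrbit hN (hS.zpow_pow_eq_one _)] at hy hy'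
      obtain ⟨m, rfl⟩ := hy
      obtain ⟨m', hm'⟩ := hy'
      exact hne (hS.eq_of_mem_T hh hh' hm')
  have hmem : x ∈ nthRootsFinset (2 ^ r) (1 : K) := (mem_nthRootsFinset hN 1).2 hx
  rw [← hunion, Finset.mem_biUnion] at hmem
  obtain ⟨h, hh, hxh⟩ := hmem
  exact ⟨h, hh, (mem_powOrbit hN (hS.zpow_pow_eq_one _)).1 hxh⟩

end Orbits

section Generator

theorem genPoly_eq_prod (hS : IsTwoPowerSetting F β a b r) (j : ℤ → ℕ) :
    genPoly F β a r j = ∏ h ∈ T a r, m F β h ^ j h := by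
  rw [genPoly, prod_T hS.two_le_a hS.two_le_r fun h => m F β h ^ j h]

theorem isIntegral_zpow (hS : IsTwoPowerSetting F β a b r) (h : ℤ) : IsIntegral F (β ^ h) :=
  IsIntegral.of_pow (n := 2 ^ r) (by positivity) (by rw [hS.zpow_pow_eq_one]; exact isIntegral_one)

theorem m_dvd (hS : IsTwoPowerSetting F β a b r) (h : ℤ) : m F β h ∣ X ^ 2 ^ r - 1 :=
  minpoly_dvd_X_pow_sub_one (hS.zpow_pow_eq_one h)

theorem monic_m (hS : IsTwoPowerSetting F β a b r) (h : ℤ) : (m F β h).Monic :=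
  minpoly.monic (hS.isIntegral_zpow h)

theorem monic_genPoly (hS : IsTwoPowerSetting F β a b r) (j : ℤ → ℕ) :
    (genPoly F β a r j).Monic := by
  rw [hS.genPoly_eq_prod]
  exact monic_prod_of_monic _ _ fun h _ => (hS.monic_m h).pow _

open Classical in
theorem rootMult_m (hS : IsTwoPowerSetting F β a b r) (h : ℤ) (x : K) :
    rootMult (m F β h) x = if ∃ k : ℕ, x = (β ^ h) ^ Fintype.card F ^ k then 1 else 0 :=
  rootMult_minpoly (by positivity) hS.prim (hS.zpow_pow_eq_one h) x

theorem rootMult_genPoly (hS : IsTwoPowerSetting F β a b r) (j : ℤ → ℕ) {h : ℤ} (hh : h ∈ T a r) :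
    rootMult (genPoly F β a r j) (β ^ h) = j h := by
  classical
  rw [hS.genPoly_eq_prod, rootMult_prod _ _ fun h _ => ((hS.monic_m h).pow _).ne_zero,
    Finset.sum_eq_single h]
  · rw [rootMult_pow (hS.monic_m h).ne_zero, hS.rootMult_m, if_pos ⟨0, by simp⟩, mul_one]
  · intro h' hh' hne
    rw [rootMult_pow (hS.monic_m h').ne_zero, hS.rootMult_m, if_neg, mul_zero]
    rintro ⟨k, hk⟩
    exact hne (hS.eq_of_mem_T hh hh' (m := 0) (by simpa using hk)).symm
  · exact fun h' => absurd hh h'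

theorem rootMult_genPoly_eq_zero (hS : IsTwoPowerSetting F β a b r) (j : ℤ → ℕ) {x : K}
    (hx : x ^ 2 ^ r ≠ 1) : rootMult (genPoly F β a r j) x = 0 := by
  classical
  rw [hS.genPoly_eq_prod, rootMult_prod _ _ fun h _ => ((hS.monic_m h).pow _).ne_zero]
  refine Finset.sum_eq_zero fun h _ => ?_
  rw [rootMult_pow (hS.monic_m h).ne_zero, hS.rootMult_m, if_neg, mul_zero]
  rintro ⟨k, rfl⟩
  apply hx
  rw [← pow_mul, mul_comm, pow_mul, hS.zpow_pow_eq_one, one_pow]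

variable (p : ℕ) [Fact p.Prime] [CharP F p] {s : ℕ}

theorem splits_genPoly (hS : IsTwoPowerSetting F β a b r) (j : ℤ → ℕ) :
    ((genPoly F β a r j).map (algebraMap F K)).Splits := by
  have : Fact (ringChar F).Prime := ⟨CharP.char_is_prime F _⟩
  rw [hS.genPoly_eq_prod, Polynomial.map_prod]
  refine Splits.prod fun h _ => ?_
  rw [Polynomial.map_pow]
  refine Splits.pow ?_ _
  refine splits_of_dvd_X_pow_sub_one (ringChar F) (s := 0) (N := 2 ^ r) (by positivity) hS.prim ?_
  simpa using hS.m_dvd h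

theorem genPoly_dvd (hS : IsTwoPowerSetting F β a b r) {j : ℤ → ℕ}
    (hj : ∀ h ∈ T a r, j h ≤ p ^ s) : genPoly F β a r j ∣ X ^ (2 ^ r * p ^ s) - 1 := by
  classical
  refine dvd_X_pow_sub_one_of_rootMult_le p (by positivity) hS.prim (hS.monic_genPoly j).ne_zero
    (hS.splits_genPoly j) fun x => ?_
  split_ifs with hx
  · obtain ⟨h, hh, k, rfl⟩ := hS.exists_mem_T hx
    rw [rootMult_pow_card_pow, hS.rootMult_genPoly j hh]
    exact hj h hh
  · rw [hS.rootMult_genPoly_eq_zero j hx]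

theorem natDegree_m (hS : IsTwoPowerSetting F β a b r) (h : ℤ) :
    (m F β h).natDegree = (powOrbit (2 ^ r) (Fintype.card F) (β ^ h)).card := by
  classical
  have : Fact (ringChar F).Prime := ⟨CharP.char_is_prime F _⟩
  rw [natDegree_eq_sum_rootMult (K := K) (ringChar F) (s := 0) (N := 2 ^ r) (by positivity) hS.prim
    (by simpa using hS.m_dvd h), powOrbit,
    Finset.card_filter]
  exact Finset.sum_congr rfl fun x _ => hS.rootMult_m h x

theorem natDegree_genPoly (hS : IsTwoPowerSetting F β a b r) (j : ℤ → ℕ) :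
    (genPoly F β a r j).natDegree =
      ∑ h ∈ T a r, j h * (powOrbit (2 ^ r) (Fintype.card F) (β ^ h)).card := by
  rw [hS.genPoly_eq_prod, natDegree_prod _ _ fun h _ => ((hS.monic_m h).pow _).ne_zero]
  exact Finset.sum_congr rfl fun h _ => by rw [natDegree_pow, hS.natDegree_m]

/-- The monic divisors of `X ^ n - 1` are the polynomials `genPoly`. -/
theorem exists_eq_genPoly (hS : IsTwoPowerSetting F β a b r) {g : F[X]} (hg : g.Monic)
    (hgd : g ∣ X ^ (2 ^ r * p ^ s) - 1) :
    (∀ h ∈ T a r, rootMult g (β ^ h) ≤ p ^ s) ∧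
      ∀ j : ℤ → ℕ, (∀ h ∈ T a r, j h = rootMult g (β ^ h)) → g = genPoly F β a r j := by
  classical
  have hle : ∀ h ∈ T a r, rootMult g (β ^ h) ≤ p ^ s := by
    intro h _
    have h₁ := rootMult_le_of_dvd_X_pow_sub_one p (by positivity) hS.prim hgd (β ^ h)
    rwa [if_pos (hS.zpow_pow_eq_one h)] at h₁
  refine ⟨hle, fun j hj => ?_⟩
  have hgen : genPoly F β a r j ∣ X ^ (2 ^ r * p ^ s) - 1 :=
    hS.genPoly_dvd p fun h hh => (hj h hh).trans_le (hle h hh)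
  refine eq_of_rootMult_eq p (by positivity) hS.prim hg (hS.monic_genPoly j) hgd hgen fun x hx => ?_
  obtain ⟨h, hh, k, rfl⟩ := hS.exists_mem_T hx
  rw [rootMult_pow_card_pow, rootMult_pow_card_pow, hS.rootMult_genPoly j hh, hj h hh]

end Generator

end IsTwoPowerSetting

section SelfAndPairReps

variable {a r : ℕ}

/-- The elements of `T a r` whose cyclotomic coset is closed under negation. -/
def selfReps (a r : ℕ) : Finset ℤ :=
  insert 0 ((Finset.Icc 1 (min a r)).biUnion fun i => (oddReps a i).image fun t => t * 2 ^ (r - i))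

/-- The positive elements of `T a r` whose cyclotomic coset is not closed under negation. -/
def pairReps (a r : ℕ) : Finset ℤ :=
  (Finset.Icc (a + 1) r).biUnion fun i =>
    ((Finset.range (2 ^ (a - 2))).image fun k => (3 : ℤ) ^ k).image fun t => t * 2 ^ (r - i)

theorem mem_selfReps {h : ℤ} :
    h ∈ selfReps a r ↔
      h = 0 ∨ ∃ i ∈ Finset.Icc 1 (min a r), ∃ t ∈ oddReps a i, t * 2 ^ (r - i) = h := by
  simp only [selfReps, Finset.mem_insert, Finset.mem_biUnion, Finset.mem_image]

theorem mem_pairReps {h : ℤ} :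
    h ∈ pairReps a r ↔
      ∃ i ∈ Finset.Icc (a + 1) r, ∃ k < 2 ^ (a - 2), (3 : ℤ) ^ k * 2 ^ (r - i) = h := by
  simp [pairReps]

theorem mem_T_iff_reps (ha : 2 ≤ a) (hr : 2 ≤ r) {h : ℤ} :
    h ∈ T a r ↔ h ∈ selfReps a r ∨ h ∈ pairReps a r ∨ -h ∈ pairReps a r := by
  rw [mem_T ha hr, mem_selfReps, mem_pairReps, mem_pairReps]
  constructor
  · rintro (h | ⟨i, hi, t, ht, rfl⟩)
    · exact Or.inl (Or.inl h)
    rw [Finset.mem_Icc] at hi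
    rcases le_or_gt i a with hia | hia
    · exact Or.inl (Or.inr ⟨i, Finset.mem_Icc.2 ⟨hi.1, le_min hia hi.2⟩, t, ht, rfl⟩)
    · right
      obtain ⟨k, hk, rfl | rfl⟩ := (mem_oddReps_of_lt hia).1 ht
      · exact Or.inl ⟨i, Finset.mem_Icc.2 ⟨hia, hi.2⟩, k, hk, rfl⟩
      · exact Or.inr ⟨i, Finset.mem_Icc.2 ⟨hia, hi.2⟩, k, hk, by ring⟩
  · rintro ((h | ⟨i, hi, t, ht, rfl⟩) | ⟨i, hi, k, hk, rfl⟩ | ⟨i, hi, k, hk, h⟩)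
    · exact Or.inl h
    · rw [Finset.mem_Icc] at hi
      exact Or.inr ⟨i, Finset.mem_Icc.2 ⟨hi.1, hi.2.trans (min_le_right _ _)⟩, t, ht, rfl⟩
    · rw [Finset.mem_Icc] at hi
      exact Or.inr ⟨i, Finset.mem_Icc.2 ⟨by omega, hi.2⟩, _,
        (mem_oddReps_of_lt hi.1).2 ⟨k, hk, Or.inl rfl⟩, rfl⟩
    · rw [Finset.mem_Icc] at hi
      refine Or.inr ⟨i, Finset.mem_Icc.2 ⟨by omega, hi.2⟩, _,
        (mem_oddReps_of_lt hi.1).2 ⟨k, hk, Or.inr rfl⟩, ?_⟩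
      rw [neg_mul, h, neg_neg]

theorem pos_of_mem_pairReps {h : ℤ} (hh : h ∈ pairReps a r) : 0 < h := by
  obtain ⟨i, -, k, -, rfl⟩ := mem_pairReps.1 hh
  positivity

theorem neg_notMem_pairReps {h : ℤ} (hh : h ∈ pairReps a r) : -h ∉ pairReps a r := fun h' => by
  have h₁ := pos_of_mem_pairReps hh
  have h₂ := pos_of_mem_pairReps h'
  omega

theorem odd_three_pow (k : ℕ) : Odd ((3 : ℤ) ^ k) := Odd.pow (by decide)

theorem notMem_selfReps_of_eq {i : ℕ} (hi : i ∈ Finset.Icc (a + 1) r) {t : ℤ} (ht : Odd t) :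
    t * 2 ^ (r - i) ∉ selfReps a r := by
  intro hh
  rw [Finset.mem_Icc] at hi
  rcases mem_selfReps.1 hh with h0 | ⟨i', hi', t', ht', h⟩
  · have : t = 0 := by simpa using h0
    exact absurd ht (by rw [this]; decide)
  · rw [Finset.mem_Icc, le_min_iff] at hi'
    have := eq_of_mul_two_pow_eq (odd_of_mem_oddReps ht') ht hi'.2.2 hi.2 h
    omega

theorem notMem_selfReps {h : ℤ} (hh : h ∈ pairReps a r) : h ∉ selfReps a r := by
  obtain ⟨i, hi, k, -, rfl⟩ := mem_pairReps.1 hh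
  exact notMem_selfReps_of_eq hi (odd_three_pow k)

theorem neg_notMem_selfReps {h : ℤ} (hh : h ∈ pairReps a r) : -h ∉ selfReps a r := by
  obtain ⟨i, hi, k, -, rfl⟩ := mem_pairReps.1 hh
  rw [← neg_mul]
  exact notMem_selfReps_of_eq hi (odd_three_pow k).neg

theorem card_pairReps (a r : ℕ) : (pairReps a r).card = (r - a) * 2 ^ (a - 2) := by
  have hodd (i : ℕ) : ∀ t ∈ (Finset.range (2 ^ (a - 2))).image fun k => (3 : ℤ) ^ k, Odd t := by
    intro t ht
    obtain ⟨k, -, rfl⟩ := Finset.mem_image.1 ht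
    exact odd_three_pow k
  rw [pairReps, Finset.card_biUnion
    (pairwiseDisjoint_image (fun i hi => (Finset.mem_Icc.1 hi).2) hodd)]
  rw [Finset.sum_congr rfl fun i _ =>
    (Finset.card_image_of_injective _ (mul_two_pow_injective (r - i))).trans
      (Finset.card_image_of_injective _ three_pow_injective), Finset.sum_const, Nat.card_Icc,
    Finset.card_range, smul_eq_mul]
  congr 1
  omega

theorem card_selfReps (ha : 2 ≤ a) (hr : 2 ≤ r) :
    (selfReps a r).card = 2 ^ (min a r - 1) + 1 := by
  have hsum (M : ℕ) (hM : 2 ≤ M) : ∑ i ∈ Finset.Icc 1 M, 2 ^ (i - 2) = 2 ^ (M - 1) := by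
    induction M, hM using Nat.le_induction with
    | base => rfl
    | succ M hM ih =>
      rw [Finset.sum_Icc_succ_top (by omega), ih, Nat.add_sub_cancel,
        show M + 1 - 2 = M - 1 by omega, ← two_mul, ← pow_succ']
      congr 1; omega
  have hle {i : ℕ} (hi : i ∈ Finset.Icc 1 (min a r)) : i ≤ a ∧ i ≤ r :=
    le_min_iff.1 (Finset.mem_Icc.1 hi).2
  rw [selfReps, Finset.card_insert_of_notMem
    (zero_notMem_biUnion_image fun i t => odd_of_mem_oddReps), Finset.card_biUnion
    (pairwiseDisjoint_image (fun i hi => (hle hi).2) fun i t => odd_of_mem_oddReps),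
    ← hsum _ (le_min ha hr)]
  congr 1
  exact Finset.sum_congr rfl fun i hi => by
    rw [Finset.card_image_of_injective _ (mul_two_pow_injective _), card_oddReps_of_le (hle hi).1]

end SelfAndPairReps

namespace IsTwoPowerSetting

variable {F : Type*} [Field F] [Fintype F] {K : Type*} [Field K] [Algebra F K]
  {β : K} {a b r : ℕ}

theorem inv_zpow_of_mem_selfReps (hS : IsTwoPowerSetting F β a b r) {h : ℤ}
    (hh : h ∈ selfReps a r) : (β ^ h)⁻¹ = (β ^ h) ^ Fintype.card F := by
  rw [← zpow_neg, ← zpow_natCast, ← zpow_mul, hS.zpow_eq_zpow_iff]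
  rcases mem_selfReps.1 hh with rfl | ⟨i, hi, t, ht, rfl⟩
  · simp
  · rw [Finset.mem_Icc, le_min_iff] at hi
    have h₁ := (modEq_neg_one_of_eq hS.card_eq hi.2.1).symm.mul_left' (c := 2 ^ (r - i))
    rw [← pow_add, Nat.sub_add_cancel hi.2.2] at h₁
    have h₂ := h₁.mul_left t
    convert h₂ using 1 <;> ring

variable (p : ℕ) [Fact p.Prime] [CharP F p] {s : ℕ}

theorem dualCode_genPoly_le_iff (hS : IsTwoPowerSetting F β a b r) {j : ℤ → ℕ}
    (hj : ∀ h ∈ T a r, j h ≤ p ^ s) :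
    dualCode (generatedCode (2 ^ r * p ^ s) (genPoly F β a r j)) ≤
        generatedCode (2 ^ r * p ^ s) (genPoly F β a r j) ↔
      (∀ h ∈ selfReps a r, 2 * j h ≤ p ^ s) ∧ ∀ h ∈ pairReps a r, j h + j (-h) ≤ p ^ s := by
  have hT := fun {h : ℤ} => mem_T_iff_reps (h := h) hS.two_le_a hS.two_le_r
  have hself {h : ℤ} (hh : h ∈ selfReps a r) :
      rootMult (genPoly F β a r j) (β ^ h)⁻¹ = j h := by
    rw [hS.inv_zpow_of_mem_selfReps hh, rootMult_pow_card,
      hS.rootMult_genPoly j (hT.2 (Or.inl hh))]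
  rw [dualCode_le_iff_rootMult p (by positivity) hS.prim (hS.genPoly_dvd p hj)]
  constructor
  · refine fun H => ⟨fun h hh => ?_, fun h hh => ?_⟩
    · have h₁ := H _ (hS.zpow_pow_eq_one h)
      rwa [hself hh, hS.rootMult_genPoly j (hT.2 (Or.inl hh)), ← two_mul] at h₁
    · have h₁ := H _ (hS.zpow_pow_eq_one h)
      rwa [← zpow_neg, hS.rootMult_genPoly j (hT.2 (Or.inr (Or.inl hh))),
        hS.rootMult_genPoly j (hT.2 (Or.inr (Or.inr (by rwa [neg_neg]))))] at h₁
  · rintro ⟨H₁, H₂⟩ x hx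
    obtain ⟨h, hh, k, rfl⟩ := hS.exists_mem_T hx
    rw [← inv_pow, rootMult_pow_card_pow, rootMult_pow_card_pow, hS.rootMult_genPoly j hh]
    rcases hT.1 hh with hh' | hh' | hh'
    · rw [hself hh', ← two_mul]
      exact H₁ h hh'
    · rw [← zpow_neg, hS.rootMult_genPoly j (hT.2 (Or.inr (Or.inr (by rwa [neg_neg]))))]
      exact H₂ h hh'
    · rw [← zpow_neg, hS.rootMult_genPoly j (hT.2 (Or.inr (Or.inl hh')))]
      have h₁ := H₂ _ hh'
      rwa [neg_neg, add_comm] at h₁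

theorem two_mul_natDegree_genPoly_lt (hS : IsTwoPowerSetting F β a b r) {j : ℤ → ℕ}
    (hj : ∀ h ∈ T a r, j h ≤ p ^ s) (h0 : 2 * j 0 < p ^ s)
    (hdual : dualCode (generatedCode (2 ^ r * p ^ s) (genPoly F β a r j)) ≤
      generatedCode (2 ^ r * p ^ s) (genPoly F β a r j)) :
    2 * (genPoly F β a r j).natDegree < 2 ^ r * p ^ s := by
  have hN : 0 < 2 ^ r := by positivity
  have hmem {x : K} : x ∈ nthRootsFinset (2 ^ r) (1 : K) ↔ x ^ 2 ^ r = 1 :=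
    mem_nthRootsFinset hN 1
  rw [dualCode_le_iff_rootMult p hN hS.prim (hS.genPoly_dvd p hj)] at hdual
  have hinv : ∑ x ∈ nthRootsFinset (2 ^ r) (1 : K), rootMult (genPoly F β a r j) x⁻¹ =
      ∑ x ∈ nthRootsFinset (2 ^ r) (1 : K), rootMult (genPoly F β a r j) x := by
    refine Finset.sum_nbij' (fun x => x⁻¹) (fun x => x⁻¹) ?_ ?_ ?_ ?_ ?_
    · intro x hx; rw [hmem] at hx ⊢; rw [inv_pow, hx, inv_one]
    · intro x hx; rw [hmem] at hx ⊢; rw [inv_pow, hx, inv_one]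
    · intro x _; exact inv_inv x
    · intro x _; exact inv_inv x
    · intro x _; rfl
  have hone : rootMult (genPoly F β a r j) (1 : K) = j 0 := by
    have h₁ := hS.rootMult_genPoly j
      ((mem_T_iff_reps hS.two_le_a hS.two_le_r).2 (Or.inl (mem_selfReps.2 (Or.inl rfl))))
    rwa [zpow_zero] at h₁
  calc 2 * (genPoly F β a r j).natDegree
      = ∑ x ∈ nthRootsFinset (2 ^ r) (1 : K),
          (rootMult (genPoly F β a r j) x + rootMult (genPoly F β a r j) x⁻¹) := by
        rw [Finset.sum_add_distrib, hinv, ← two_mul,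
          natDegree_eq_sum_rootMult p hN hS.prim (hS.genPoly_dvd p hj)]
    _ < ∑ x ∈ nthRootsFinset (2 ^ r) (1 : K), p ^ s := by
        refine Finset.sum_lt_sum (fun x hx => hdual x (hmem.1 hx)) ⟨1, hmem.2 (one_pow _), ?_⟩
        rwa [inv_one, hone, ← two_mul]
    _ = 2 ^ r * p ^ s := by
        rw [Finset.sum_const, hS.prim.card_nthRootsFinset, smul_eq_mul]

theorem cssYields_genPoly [DecidableEq F] [Algebra (ZMod p) F]
    (hS : IsTwoPowerSetting F β a b r) {j : ℤ → ℕ} (hj : ∀ h ∈ T a r, j h ≤ p ^ s)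
    (h0 : 2 * j 0 < p ^ s) (hself : ∀ h ∈ selfReps a r, 2 * j h ≤ p ^ s)
    (hpair : ∀ h ∈ pairReps a r, j h + j (-h) ≤ p ^ s) :
    CSSYields p (generatedCode (2 ^ r * p ^ s) (genPoly F β a r j))
      (2 ^ r * p ^ s - 2 * (genPoly F β a r j).natDegree) := by
  have hps : 0 < p ^ s := pow_pos (Fact.out : p.Prime).pos s
  have hn : 0 < 2 ^ r * p ^ s := by positivity
  have hle := (hS.dualCode_genPoly_le_iff p hj).2 ⟨hself, hpair⟩
  have hlt := hS.two_mul_natDegree_genPoly_lt p hj h0 hle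
  have hfin := finrank_generatedCode hn (hS.genPoly_dvd p hj)
  have hfin' := finrank_dualCode (generatedCode (2 ^ r * p ^ s) (genPoly F β a r j))
  rw [hfin] at hfin'
  refine cssYields_of_dualCode_lt (lt_of_le_of_ne hle fun h => ?_) ?_
  · rw [h, hfin] at hfin'
    omega
  · rw [hfin, hfin']
    zify [(by omega : 2 ^ r * p ^ s - (2 ^ r * p ^ s - (genPoly F β a r j).natDegree) ≤
      2 ^ r * p ^ s - (genPoly F β a r j).natDegree),
      (by omega : (genPoly F β a r j).natDegree ≤ 2 ^ r * p ^ s),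
      (by omega : 2 ^ r * p ^ s - (genPoly F β a r j).natDegree ≤ 2 ^ r * p ^ s)]
    ring

theorem natDegree_genPoly_eq (hS : IsTwoPowerSetting F β a b r) (j : ℤ → ℕ) :
    (genPoly F β a r j).natDegree = j 0 + j (2 ^ (r - 1)) + 2 * j (2 ^ (r - 2)) +
      2 * ∑ i ∈ Finset.Icc 3 (min a r), ∑ t ∈ O a i, j (t * 2 ^ (r - i)) +
      ∑ i ∈ Finset.Icc (a + 1) r, ∑ t ∈ O a i, 2 ^ (i - a) * j (t * 2 ^ (r - i)) := by
  have ha := hS.two_le_a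
  have hr := hS.two_le_r
  have h₁ := hS.card_powOrbit_zpow (i := 1) (by omega) odd_one
  have h₂ := hS.card_powOrbit_zpow (i := 2) (by omega) odd_one
  rw [one_mul] at h₁ h₂
  have hsplit : Finset.Icc 3 r = Finset.Icc 3 (min a r) ∪ Finset.Icc (a + 1) r := by
    ext i; simp only [Finset.mem_Icc, Finset.mem_union, le_min_iff]; omega
  have hdisj : Disjoint (Finset.Icc 3 (min a r)) (Finset.Icc (a + 1) r) := by
    rw [Finset.disjoint_left]
    intro i hi hi'
    rw [Finset.mem_Icc] at hi hi'
    omega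
  have hO {i : ℕ} (hi : 3 ≤ i) {t : ℤ} (ht : t ∈ O a i) : Odd t := by
    rw [← oddReps_of_three_le ha hi] at ht
    exact odd_of_mem_oddReps ht
  rw [hS.natDegree_genPoly, sum_T ha hr, hS.card_powOrbit_one, h₁, h₂, hsplit,
    Finset.sum_union hdisj, ← add_assoc]
  have hc1 : cosetSize a 1 = 1 := rfl
  have hc2 : cosetSize a 2 = 2 := by rw [cosetSize, if_neg (by omega), if_pos ha]
  rw [hc1, hc2, mul_one, mul_one, mul_comm (j (2 ^ (r - 2))) 2, Finset.mul_sum]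
  congr 1
  · congr 1
    refine Finset.sum_congr rfl fun i hi => ?_
    rw [Finset.mem_Icc, le_min_iff] at hi
    rw [Finset.mul_sum]
    refine Finset.sum_congr rfl fun t ht => ?_
    rw [hS.card_powOrbit_zpow hi.2.2 (hO hi.1 ht), cosetSize, if_neg (by omega), if_pos hi.2.1,
      mul_comm]
  · refine Finset.sum_congr rfl fun i hi => ?_
    rw [Finset.mem_Icc] at hi
    refine Finset.sum_congr rfl fun t ht => ?_
    rw [hS.card_powOrbit_zpow hi.2 (hO (by omega) ht), cosetSize, if_neg (by omega),
      if_neg (by omega), mul_comm]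

/-- The quantum codes obtained from the codes generated by `genPoly`. -/
theorem cssYields_genPoly_of_sums [DecidableEq F] [Algebra (ZMod p) F]
    (hS : IsTwoPowerSetting F β a b r) {j : ℤ → ℕ} (hj : ∀ h ∈ T a r, j h ≤ p ^ s)
    (h0 : 2 * j 0 < p ^ s) (h₁ : 2 * j (2 ^ (r - 1)) < p ^ s) (h₂ : 2 * j (2 ^ (r - 2)) < p ^ s)
    (hself : ∀ i ∈ Finset.Icc 3 (min a r), ∀ t ∈ O a i, 2 * j (t * 2 ^ (r - i)) ≤ p ^ s)
    (hpair : ∀ i ∈ Finset.Icc (a + 1) r, ∀ t ∈ O a i,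
      j (t * 2 ^ (r - i)) + j (-t * 2 ^ (r - i)) ≤ p ^ s) :
    CSSYields p (generatedCode (2 ^ r * p ^ s) (genPoly F β a r j))
      (2 ^ r * p ^ s - 2 * j 0 - 2 * j (2 ^ (r - 1)) - 4 * j (2 ^ (r - 2))
        - 4 * ∑ i ∈ Finset.Icc 3 (min a r), ∑ t ∈ O a i, (j (t * 2 ^ (r - i)) : ℤ)
        - 2 * ∑ i ∈ Finset.Icc (a + 1) r, ∑ t ∈ O a i,
            2 ^ (i - a) * (j (t * 2 ^ (r - i)) : ℤ)) := by
  have ha := hS.two_le_a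
  convert hS.cssYields_genPoly p hj h0 (fun h hh => ?_) (fun h hh => ?_) using 1
  · rw [hS.natDegree_genPoly_eq]
    push_cast
    ring
  · rcases mem_selfReps.1 hh with rfl | ⟨i, hi, t, ht, rfl⟩
    · exact h0.le
    rw [Finset.mem_Icc] at hi
    rcases Nat.lt_or_ge i 3 with hi3 | hi3
    · rw [oddReps_of_le_two ha (by omega), Finset.mem_singleton] at ht
      subst ht
      rw [one_mul]
      have : i = 1 ∨ i = 2 := by omega
      rcases this with rfl | rfl
      exacts [h₁.le, h₂.le]
    · rw [oddReps_of_three_le ha hi3] at ht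
      exact hself i (Finset.mem_Icc.2 ⟨hi3, hi.2⟩) t ht
  · obtain ⟨i, hi, k, hk, rfl⟩ := mem_pairReps.1 hh
    have hia := Finset.mem_Icc.1 hi
    rw [← neg_mul]
    refine hpair i hi _ ?_
    rw [← oddReps_of_three_le ha (by omega)]
    exact (mem_oddReps_of_lt hia.1).2 ⟨k, hk, Or.inl rfl⟩

end IsTwoPowerSetting

section Counting

variable {a r : ℕ}

/-- The pairs of natural numbers with sum at most `P`. -/
def sumLePairs (P : ℕ) : Finset (Σ _ : ℕ, ℕ) :=
  (Finset.range (P + 1)).sigma fun x => Finset.range (P + 1 - x)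

theorem mem_sumLePairs {P : ℕ} {z : Σ _ : ℕ, ℕ} : z ∈ sumLePairs P ↔ z.1 + z.2 ≤ P := by
  rw [sumLePairs, Finset.mem_sigma, Finset.mem_range, Finset.mem_range]
  omega

theorem card_sumLePairs_of_odd {P : ℕ} (hP : Odd P) :
    (sumLePairs P).card = (P + 2) * ((P + 1) / 2) := by
  have hsum (n : ℕ) : 2 * ∑ x ∈ Finset.range n, (n - x) = n * (n + 1) := by
    induction n with
    | zero => rfl
    | succ n ih =>
      rw [Finset.sum_range_succ']
      simp only [Nat.add_sub_add_right, Nat.sub_zero]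
      rw [mul_add, ih]
      ring
  rw [sumLePairs, Finset.card_sigma, Finset.sum_congr rfl fun x _ => Finset.card_range _]
  obtain ⟨c, rfl⟩ := hP
  have h₁ := hsum (2 * c + 1 + 1)
  have h₂ : (2 * c + 1 + 1) / 2 = c + 1 := by omega
  rw [h₂]
  refine Nat.eq_of_mul_eq_mul_left two_pos (h₁.trans ?_)
  ring

/-- The parameters of a dual-containing cyclic code: one exponent for each coset closed under
negation, and two exponents for each pair of opposite cosets. -/
abbrev Exponents (a r P : ℕ) : Type :=
  (selfReps a r → Finset.range (P / 2 + 1)) × (pairReps a r → sumLePairs P)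

/-- The exponent function on `T a r` given by the parameters. -/
def Exponents.toFun {P : ℕ} (e : Exponents a r P) (h : ℤ) : ℕ :=
  if h₁ : h ∈ selfReps a r then e.1 ⟨h, h₁⟩
  else if h₂ : h ∈ pairReps a r then (e.2 ⟨h, h₂⟩).1.1
  else if h₃ : -h ∈ pairReps a r then (e.2 ⟨-h, h₃⟩).1.2
  else 0

theorem Exponents.toFun_self {P : ℕ} (e : Exponents a r P) {h : ℤ} (hh : h ∈ selfReps a r) :
    e.toFun h = e.1 ⟨h, hh⟩ := dif_pos hh

theorem Exponents.toFun_pair {P : ℕ} (e : Exponents a r P) {h : ℤ} (hh : h ∈ pairReps a r) :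
    e.toFun h = (e.2 ⟨h, hh⟩).1.1 := by
  rw [Exponents.toFun, dif_neg (notMem_selfReps hh), dif_pos hh]

theorem Exponents.toFun_neg {P : ℕ} (e : Exponents a r P) {h : ℤ} (hh : h ∈ pairReps a r) :
    e.toFun (-h) = (e.2 ⟨h, hh⟩).1.2 := by
  rw [Exponents.toFun, dif_neg (neg_notMem_selfReps hh), dif_neg (neg_notMem_pairReps hh),
    dif_pos (by rwa [neg_neg])]
  simp only [neg_neg]

theorem Exponents.two_mul_toFun_le {P : ℕ} (e : Exponents a r P) {h : ℤ}
    (hh : h ∈ selfReps a r) : 2 * e.toFun h ≤ P := by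
  rw [e.toFun_self hh]
  have := Finset.mem_range.1 (e.1 ⟨h, hh⟩).2
  omega

theorem Exponents.toFun_add_le {P : ℕ} (e : Exponents a r P) {h : ℤ} (hh : h ∈ pairReps a r) :
    e.toFun h + e.toFun (-h) ≤ P := by
  rw [e.toFun_pair hh, e.toFun_neg hh]
  exact mem_sumLePairs.1 (e.2 ⟨h, hh⟩).2

theorem le_of_mem_T_of_constraints (ha : 2 ≤ a) (hr : 2 ≤ r) {P : ℕ} {j : ℤ → ℕ}
    (hself : ∀ h ∈ selfReps a r, 2 * j h ≤ P)
    (hpair : ∀ h ∈ pairReps a r, j h + j (-h) ≤ P) : ∀ h ∈ T a r, j h ≤ P := by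
  intro h hh
  rcases (mem_T_iff_reps ha hr).1 hh with hh | hh | hh
  · have := hself h hh
    omega
  · have := hpair h hh
    omega
  · have := hpair _ hh
    rw [neg_neg] at this
    omega

theorem Exponents.exists_toFun_eq {P : ℕ} (ha : 2 ≤ a) (hr : 2 ≤ r) {j : ℤ → ℕ}
    (hself : ∀ h ∈ selfReps a r, 2 * j h ≤ P)
    (hpair : ∀ h ∈ pairReps a r, j h + j (-h) ≤ P) :
    ∃ e : Exponents a r P, ∀ h ∈ T a r, e.toFun h = j h := by
  refine ⟨⟨fun h => ⟨j h, Finset.mem_range.2 ?_⟩,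
    fun h => ⟨⟨j h, j (-h)⟩, mem_sumLePairs.2 (hpair h h.2)⟩⟩, fun h hh => ?_⟩
  · have := hself h h.2
    omega
  · rcases (mem_T_iff_reps ha hr).1 hh with hh | hh | hh
    · rw [Exponents.toFun_self _ hh]
    · rw [Exponents.toFun_pair _ hh]
    · obtain ⟨h', rfl⟩ : ∃ h', h = -h' := ⟨-h, (neg_neg h).symm⟩
      rw [neg_neg] at hh
      rw [Exponents.toFun_neg _ hh]

theorem Exponents.ext_toFun {P : ℕ} (ha : 2 ≤ a) (hr : 2 ≤ r) {e e' : Exponents a r P}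
    (H : ∀ h ∈ T a r, e.toFun h = e'.toFun h) : e = e' := by
  have hT := fun {h : ℤ} => mem_T_iff_reps (h := h) ha hr
  refine Prod.ext (funext fun h => Subtype.ext ?_) (funext fun h => Subtype.ext ?_)
  · have h₁ := H h (hT.2 (Or.inl h.2))
    rwa [Exponents.toFun_self _ h.2, Exponents.toFun_self _ h.2] at h₁
  · have h₁ := H h (hT.2 (Or.inr (Or.inl h.2)))
    have h₂ := H (-h) (hT.2 (Or.inr (Or.inr (by rw [neg_neg]; exact h.2))))
    rw [Exponents.toFun_pair _ h.2, Exponents.toFun_pair _ h.2] at h₁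
    rw [Exponents.toFun_neg _ h.2, Exponents.toFun_neg _ h.2] at h₂
    exact Sigma.ext h₁ (heq_of_eq h₂)

theorem card_exponents (ha : 2 ≤ a) (hr : 2 ≤ r) {P : ℕ} (hP : Odd P) :
    Fintype.card (Exponents a r P) = (P + 2) ^ ((r - a) * 2 ^ (a - 2)) *
      ((P + 1) / 2) ^ (2 ^ (min a r - 1) + (r - a) * 2 ^ (a - 2) + 1) := by
  have h : P / 2 + 1 = (P + 1) / 2 := by
    obtain ⟨c, rfl⟩ := hP
    omega
  rw [Fintype.card_prod, Fintype.card_fun, Fintype.card_fun, Fintype.card_coe, Fintype.card_coe,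
    Fintype.card_coe, Fintype.card_coe, Finset.card_range, card_selfReps ha hr, card_pairReps,
    card_sumLePairs_of_odd hP, h, mul_pow]
  ring

end Counting

namespace IsTwoPowerSetting

variable {F : Type*} [Field F] [Fintype F] {K : Type*} [Field K] [Algebra F K]
  {β : K} {a b r : ℕ} (p : ℕ) [CharP F p]

theorem odd_char_pow (hS : IsTwoPowerSetting F β a b r) (s : ℕ) : Odd (p ^ s) := by
  have h : p ∣ Fintype.card F :=
    (CharP.cast_eq_zero_iff F p _).1 (FiniteField.cast_card_eq_zero F)
  exact (hS.odd_card.of_dvd_nat h).pow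

variable [Fact p.Prime] {s : ℕ}

theorem cyclicCSSCodes_eq_range (hS : IsTwoPowerSetting F β a b r) :
    cyclicCSSCodes F (2 ^ r * p ^ s) = Set.range fun e : Exponents a r (p ^ s) =>
      css (generatedCode (2 ^ r * p ^ s) (genPoly F β a r e.toFun))
        (dualCode (generatedCode (2 ^ r * p ^ s) (genPoly F β a r e.toFun))) := by
  have ha := hS.two_le_a
  have hr := hS.two_le_r
  have hps : 0 < p ^ s := pow_pos (Fact.out : p.Prime).pos s
  have hn : 0 < 2 ^ r * p ^ s := by positivity
  ext Q
  constructor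
  · rintro ⟨C, hC, hle, rfl⟩
    obtain ⟨g, hg, hgd, rfl⟩ := hC.exists_generator hn
    obtain ⟨hbound, hgen⟩ := hS.exists_eq_genPoly p hg hgd
    have hg' := hgen (fun h => rootMult g (β ^ h)) fun _ _ => rfl
    rw [hg'] at hle
    obtain ⟨h₁, h₂⟩ := (hS.dualCode_genPoly_le_iff p hbound).1 hle
    obtain ⟨e, he⟩ := Exponents.exists_toFun_eq ha hr h₁ h₂
    refine ⟨e, ?_⟩
    dsimp only
    rw [← hgen e.toFun he]
  · rintro ⟨e, rfl⟩
    have hself := fun h (hh : h ∈ selfReps a r) => e.two_mul_toFun_le hh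
    have hpair := fun h (hh : h ∈ pairReps a r) => e.toFun_add_le hh
    have hj := le_of_mem_T_of_constraints ha hr hself hpair
    exact ⟨_, isCyclicCode_generatedCode (hS.genPoly_dvd p hj),
      (hS.dualCode_genPoly_le_iff p hj).2 ⟨hself, hpair⟩, rfl⟩

theorem css_genPoly_injective (hS : IsTwoPowerSetting F β a b r) :
    Function.Injective fun e : Exponents a r (p ^ s) =>
      css (generatedCode (2 ^ r * p ^ s) (genPoly F β a r e.toFun))
        (dualCode (generatedCode (2 ^ r * p ^ s) (genPoly F β a r e.toFun))) := by
  have ha := hS.two_le_a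
  have hr := hS.two_le_r
  have hps : 0 < p ^ s := pow_pos (Fact.out : p.Prime).pos s
  have hj (e : Exponents a r (p ^ s)) : ∀ h ∈ T a r, e.toFun h ≤ p ^ s :=
    le_of_mem_T_of_constraints ha hr (fun h hh => e.two_mul_toFun_le hh)
      fun h hh => e.toFun_add_le hh
  have hdual (e : Exponents a r (p ^ s)) := (hS.dualCode_genPoly_le_iff p (hj e)).2
    ⟨fun h hh => e.two_mul_toFun_le hh, fun h hh => e.toFun_add_le hh⟩
  intro e e' hee
  have hcode := css_dualCode_inj (hdual e) (hdual e') hee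
  have hn : 0 < 2 ^ r * p ^ s := by positivity
  have hgen : genPoly F β a r e.toFun = genPoly F β a r e'.toFun :=
    eq_of_monic_of_associated (hS.monic_genPoly _) (hS.monic_genPoly _) (associated_of_dvd_dvd
      (dvd_of_generatedCode_le hn (hS.genPoly_dvd p (hj e')) (hS.genPoly_dvd p (hj e)) hcode.ge)
      (dvd_of_generatedCode_le hn (hS.genPoly_dvd p (hj e)) (hS.genPoly_dvd p (hj e')) hcode.le))
  refine Exponents.ext_toFun ha hr fun h hh => ?_
  rw [← hS.rootMult_genPoly e.toFun hh, hgen, hS.rootMult_genPoly e'.toFun hh]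

/-- The number of quantum codes obtained from dual-containing cyclic codes. -/
theorem ncard_cyclicCSSCodes (hS : IsTwoPowerSetting F β a b r) :
    (cyclicCSSCodes F (2 ^ r * p ^ s)).ncard = (p ^ s + 2) ^ ((r - a) * 2 ^ (a - 2)) *
      ((p ^ s + 1) / 2) ^ (2 ^ (min a r - 1) + (r - a) * 2 ^ (a - 2) + 1) := by
  rw [hS.cyclicCSSCodes_eq_range p, ← Set.image_univ,
    Set.ncard_image_of_injective _ (hS.css_genPoly_injective p), Set.ncard_univ,
    Nat.card_eq_fintype_card,
    card_exponents hS.two_le_a hS.two_le_r (hS.odd_char_pow p s)]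

end IsTwoPowerSetting

end QCode

theorem theorem10
    (p : ℕ) [Fact p.Prime]
    (F : Type*) [Field F] [Fintype F] [DecidableEq F] [Algebra (ZMod p) F]
    (a b r s : ℕ) (ha : 2 ≤ a) (hb : Odd b) (hr : 2 ≤ r)
    (hq : Fintype.card F = 2 ^ a * b - 1)
    (K : Type*) [Field K] [Algebra F K] (β : K) (hβ : IsPrimitiveRoot β (2 ^ r)) :
    (a = 2 →
      (∀ j : ℤ → ℕ, (∀ h ∈ QCode.T a r, j h ≤ p ^ s) →
        2 * j 0 < p ^ s → 2 * j (2 ^ (r - 1)) < p ^ s → 2 * j (2 ^ (r - 2)) < p ^ s →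
        (∀ i ∈ Finset.Icc 3 r, ∀ t ∈ QCode.O a i,
          j (t * 2 ^ (r - i)) + j (-t * 2 ^ (r - i)) ≤ p ^ s) →
        QCode.CSSYields p
          (QCode.generatedCode (2 ^ r * p ^ s) (QCode.genPoly F β a r j))
          (2 ^ r * p ^ s - 2 * j 0 - 2 * j (2 ^ (r - 1)) - 4 * j (2 ^ (r - 2))
            - 2 * ∑ i ∈ Finset.Icc 3 r, ∑ t ∈ QCode.O a i,
                2 ^ (i - a) * (j (t * 2 ^ (r - i)) : ℤ))) ∧
      (QCode.cyclicCSSCodes F (2 ^ r * p ^ s)).ncard =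
        (p ^ s + 2) ^ (r - 2) * ((p ^ s + 1) / 2) ^ (r + 1)) ∧
    (3 ≤ a →
      (∀ j : ℤ → ℕ, (∀ h ∈ QCode.T a r, j h ≤ p ^ s) →
        2 * j 0 < p ^ s → 2 * j (2 ^ (r - 1)) < p ^ s → 2 * j (2 ^ (r - 2)) < p ^ s →
        (∀ i ∈ Finset.Icc 3 (min a r), ∀ t ∈ QCode.O a i,
          2 * j (t * 2 ^ (r - i)) ≤ p ^ s) →
        (∀ i ∈ Finset.Icc (a + 1) r, ∀ t ∈ QCode.O a i,
          j (t * 2 ^ (r - i)) + j (-t * 2 ^ (r - i)) ≤ p ^ s) →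
        QCode.CSSYields p
          (QCode.generatedCode (2 ^ r * p ^ s) (QCode.genPoly F β a r j))
          (2 ^ r * p ^ s - 2 * j 0 - 2 * j (2 ^ (r - 1)) - 4 * j (2 ^ (r - 2))
            - 4 * ∑ i ∈ Finset.Icc 3 (min a r), ∑ t ∈ QCode.O a i, (j (t * 2 ^ (r - i)) : ℤ)
            - 2 * ∑ i ∈ Finset.Icc (a + 1) r, ∑ t ∈ QCode.O a i,
                2 ^ (i - a) * (j (t * 2 ^ (r - i)) : ℤ))) ∧
      (a ≤ r → (QCode.cyclicCSSCodes F (2 ^ r * p ^ s)).ncard =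
        (p ^ s + 2) ^ ((r - a) * 2 ^ (a - 2)) *
          ((p ^ s + 1) / 2) ^ (2 ^ (a - 1) + (r - a) * 2 ^ (a - 2) + 1)) ∧
      (r < a → (QCode.cyclicCSSCodes F (2 ^ r * p ^ s)).ncard =
        ((p ^ s + 1) / 2) ^ (2 ^ (r - 1) + 1))) := by
  have : CharP F p := charP_of_injective_algebraMap (algebraMap (ZMod p) F).injective p
  have hcard : (Fintype.card F : ℤ) = 2 ^ a * b - 1 := by
    have hb0 : 0 < 2 ^ a * b := by
      have := hb.pos
      positivity
    rw [hq]
    push_cast [Nat.cast_sub hb0]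
    rfl
  have hS : QCode.IsTwoPowerSetting F β a b r := ⟨ha, hb, hr, hcard, hβ⟩
  have hncard := hS.ncard_cyclicCSSCodes p (s := s)
  refine ⟨?_, fun _ => ⟨fun j hj h₀ h₁ h₂ hself hpair =>
    hS.cssYields_genPoly_of_sums p hj h₀ h₁ h₂ hself hpair, fun har => ?_, fun hra => ?_⟩⟩
  · rintro rfl
    refine ⟨fun j hj h₀ h₁ h₂ hpair => ?_, ?_⟩
    · have hempty : Finset.Icc 3 (min 2 r) = ∅ := Finset.Icc_eq_empty (by omega)
      have h := hS.cssYields_genPoly_of_sums p hj h₀ h₁ h₂ (by simp) hpair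
      rw [hempty, Finset.sum_empty, mul_zero, sub_zero] at h
      exact h
    · rw [hncard, min_eq_left hr]
      congr 2
      · simp
      · simp only [Nat.sub_self, pow_zero, mul_one, Nat.reduceSub, pow_one]
        omega
  · rw [hncard, min_eq_left har]
  · rw [hncard, min_eq_right hra.le, Nat.sub_eq_zero_of_le hra.le, zero_mul, pow_zero, one_mul,
      add_zero]
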